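/- **Setting.** Let $G=(V,E)$ be a finite connected undirected graph with edge costs $c_e\ge 0$ and shortest-path distance $d$. A sequence $R$ of requests (vertices) arrives online one by one; a finite sequence $\hat R$ of predicted requests is known in advance; both may contain repetitions (elements are then counted with multiplicity) and may have any lengths. The problems are: * *Steiner tree*: given a root $\rho$, maintain a growing edge set $S$ connecting each arrived request to $\rho$; the cost is $\sum_{e\in S}c_e$. * *Facility location*: facilities can be opened at any time at a vertex $v$ at cost $f_v\ge 0$; each arriving client is connected immediately and irrevocably to an open facility at cost equal to the distance; the cost is the total opening and connection cost. * *Soft-capacitated facility location*: in addition, each facility opened at $v$ serves at most $\beta_v\ge 1$ clients, and several facilities may be opened at $v$, each at cost $f_v$. $\mathrm{OPT}$ is the optimal offline cost for $R$. **Cover error.** A $k$-hyperedge cover of $A$ by $B$ is a finite set $\mathcal H$ of pairs $(A',b)$ with $A'\subseteq A$, $|A'|\le k$, $b\in B$, such that each $a\in A$ is in some $A'$. $\Gamma_k(A,B)$ is the minimum cost of such a cover ($\infty$ if there is none). For Steiner tree the cost is $\sum_{(A',b)\in\mathcal H}\gamma(A',b)$, where $\gamma(A',b)$ is the cost of an optimal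 Steiner tree for terminals $A'$ with root $b$. For the two facility location problems it is $\sum_{(A',b)\in\mathcal H}\gamma(A',b)-\sum_{b}f_b$, the last sum over those $b\in B$ whose hyperedges cover exactly one element of $A$ in total, where $\gamma(A',b)=f_b+\sum_{a\in A'}d(a,b)$, respectively $\gamma(A',b)=f_b\lceil |A'|/\beta_b\rceil+\sum_{a\in A'}d(a,b)$ in the soft-capacitated case. The cover error is $\Lambda_k=\Gamma_\infty(\hat R,R)+\Gamma_k(R,\hat R)$. **Algorithms** (Azar, Panigrahi, Touitou). Let PC be any $\nu$-approximation algorithm for the prize-collecting offline problem on $\hat R$ (solution cost plus penalties of unsatisfied requests). For $u\in\mathbb N$, $\mathrm{Partial}(u)$ is the output of PC for the first of the uniform penalties $0,x_0,2x_0,4x_0,\dots$ (where $x_0>0$ is arbitrary) for which at most $2\nu u$ requests of $\hat R$ are left unsatisfied. Each arriving request is served by an online algorithm ON, which may use everything bought so far at cost zero. Let $B$ be the total cost paid by ON so far and $\hat B$ the value of $B$ at the latest major iteration (initially $0$). If $B\ge 2\hat B$ after ON has served the request, the iteration is major: $\hat B$ is set to $B$, $\mathrm{Partial}(u)$ is bought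 for the least $u$ for which its cost is at most $3\nu\hat B$, and ON is restarted. * For Steiner tree, ON is Greedy: it connects the request to the root by a shortest path, where bought edges have cost zero. * For facility location, ON is Fotakis' primal-dual algorithm. Let $F$ be the set of open facilities and $L$ the set of clients that arrived since the last restart. When a client $x$ arrives, put $t_z=f_z-\sum_{y\in L}\max\{0,d(F,y)-d(z,y)\}+d(z,x)$ for $z\in V$. If $d(F,x)\le\min_z t_z$, no facility is opened; if $\min_z t_z\le d(F,x)$, a facility $z\notin F$ minimising $t_z$ is opened (at equality either may happen; $d(\emptyset,x)=\infty$). Then $x$ is connected to the closest open facility. * For soft-capacitated facility location, the facility location algorithm is run with the connection cost of a client $x$ to a facility at $v$ replaced by $d(v,x)+f_v/\beta_v$ (both in ON and in the prize-collecting problem); one facility is opened at $v$ when that algorithm opens $v$, and a further one whenever a client is connected to $v$ and all facilities there are full. **Theorem 3.** For every $\nu\ge 1$ there is a constant $C>0$, depending on $\nu$ only, such that for each of the three problems, every instance, every prediction $\hat R$, every such PC, and every $x_0>0$, the algorithm can be executed on $R$, and for every way in which ties are broken its cost is at most $$C\cdot\mathrm{OPT}+C\,(1+\log k)\cdot\Lambda_k\qquad\text{simultaneously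 for all integers }k\ge 1 .$$ -/

import Mathlib

open scoped ENNReal

universe u

noncomputable section

/-! ### Hyperedge covers and the cover error -/

section Cover

variable {A B : Type*}

/-- `H` is a `k`-hyperedge cover of `A` by `B`. A hyperedge `(A', b)` has the endpoint `b` in `B`
and the endpoints `A'` in `A`, of which there are at most `k`; every element of `A` has to lie in
some hyperedge of `H`. -/
def IsHyperedgeCover (k : ℕ∞) (H : Finset (Finset A × B)) : Prop :=
  (∀ h ∈ H, (h.1.card : ℕ∞) ≤ k) ∧ ∀ a : A, ∃ h ∈ H, a ∈ h.1

/-- The minimum cost of a `k`-hyperedge cover of `A` by `B`; it is `∞` if there is no cover. -/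
def coverValue (cost : Finset (Finset A × B) → ℝ) (k : ℕ∞) : ℝ≥0∞ :=
  ⨅ (H : Finset (Finset A × B)) (_ : IsHyperedgeCover k H), ENNReal.ofReal (cost H)

/-- The total cost of a set of hyperedges with hyperedge costs `γ`. -/
def sumCost (γ : Finset A → B → ℝ) (H : Finset (Finset A × B)) : ℝ :=
  ∑ h ∈ H, γ h.1 h.2

open Classical in
/-- The subset of `A` that is covered by `b` in `H`. -/
def coveredBy (H : Finset (Finset A × B)) (b : B) : Finset A :=
  (H.filter fun h => h.2 = b).biUnion fun h => h.1

open Classical in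
/-- The refined total cost: the opening cost `f b` is deducted for every `b` that covers
exactly one element of `A`. -/
def refinedCost [Fintype B] (f : B → ℝ) (γ : Finset A → B → ℝ) (H : Finset (Finset A × B)) : ℝ :=
  sumCost γ H - ∑ b ∈ Finset.univ.filter (fun b => (coveredBy H b).card = 1), f b

end Cover

/-! ### The framework: an online algorithm combined with partial solutions for the prediction -/

/-- An offline prize-collecting problem with request set `ι`: its solutions, their costs, and the
requests that they leave unsatisfied. -/
structure PrizeCollecting (ι Sol : Type*) where
  IsSol : Sol → Prop
  cost : Sol → ℝ
  unsat : Sol → Finset ι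

namespace PrizeCollecting

variable {ι Sol : Type*} (P : PrizeCollecting ι Sol)

/-- Cost of the solution plus penalties of the unsatisfied requests. -/
def pcCost (pen : ι → ℝ) (S : Sol) : ℝ := P.cost S + ∑ i ∈ P.unsat S, pen i

/-- `PC` is a `ν`-approximation algorithm for the prize-collecting problem. -/
def IsApprox (ν : ℝ) (PC : (ι → ℝ) → Sol) : Prop :=
  ∀ pen : ι → ℝ, (∀ i, 0 ≤ pen i) →
    P.IsSol (PC pen) ∧ ∀ S, P.IsSol S → P.pcCost pen (PC pen) ≤ ν * P.pcCost pen S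

/-- `PC`, run with the uniform penalty `x`, leaves at most `2 ν u` requests unsatisfied. -/
def LeavesFew (ν : ℝ) (PC : (ι → ℝ) → Sol) (u : ℕ) (x : ℝ) : Prop :=
  ((P.unsat (PC fun _ => x)).card : ℝ) ≤ 2 * ν * u

open Classical in
/-- The subroutine Partial with target number `u` of unsatisfied requests: run `PC` with the
uniform penalties `0, x₀, 2 x₀, 4 x₀, …` and return its first output that leaves at most `2 ν u`
requests unsatisfied. (For `u = 0`, all requests are satisfied.) -/
def partialSol (ν x₀ : ℝ) (PC : (ι → ℝ) → Sol) (u : ℕ) : Sol :=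
  if P.LeavesFew ν PC u 0 then PC fun _ => 0
  else PC fun _ => x₀ * 2 ^ sInf {n : ℕ | P.LeavesFew ν PC u (x₀ * 2 ^ n)}

end PrizeCollecting

/-- The components that the framework combines: the prize-collecting offline problem for the
predicted requests `ι`; an online algorithm with configurations `Cfg` (`on s r s' g`: in
configuration `s`, it may serve the request `r` by moving to configuration `s'` at cost `g`); and
the effect of buying an offline solution, after which the online algorithm is restarted with
everything bought so far available at cost zero. -/
structure Components (ι Sol Cfg Req : Type*) where
  offline : PrizeCollecting ι Sol
  start : Cfg
  on : Cfg → Req → Cfg → ℝ → Prop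
  buy : Sol → Cfg → Cfg

/-- State of the framework: the configuration, the total cost `total` paid so far by the online
algorithm, and the value `last` of this total at the latest major iteration. -/
structure FrameworkState (Cfg : Type*) where
  cfg : Cfg
  total : ℝ
  last : ℝ

/-- `Run A ν x₀ PC R s`: the framework may reach state `s` by serving the request sequence `R`
(all ways of breaking ties of the online algorithm are allowed). Each request is served by the
online algorithm. If thereby the total online cost has at least doubled since the latest major
iteration, then the iteration is major: with the new total `T`, the solution Partial with the
least `u` for which it costs at most `3 ν T` is bought. -/
inductive Run {ι Sol Cfg Req : Type*} (A : Components ι Sol Cfg Req) (ν x₀ : ℝ)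
    (PC : (ι → ℝ) → Sol) : List Req → FrameworkState Cfg → Prop
  | nil : Run A ν x₀ PC [] ⟨A.start, 0, 0⟩
  | minor {R : List Req} {s : FrameworkState Cfg} {r : Req} {c : Cfg} {g : ℝ} :
      Run A ν x₀ PC R s → A.on s.cfg r c g → s.total + g < 2 * s.last →
      Run A ν x₀ PC (R ++ [r]) ⟨c, s.total + g, s.last⟩
  | major {R : List Req} {s : FrameworkState Cfg} {r : Req} {c : Cfg} {g : ℝ} {u : ℕ} :
      Run A ν x₀ PC R s → A.on s.cfg r c g → 2 * s.last ≤ s.total + g →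
      IsLeast {u : ℕ | A.offline.cost (A.offline.partialSol ν x₀ PC u)
        ≤ 3 * ν * (s.total + g)} u →
      Run A ν x₀ PC (R ++ [r])
        ⟨A.buy (A.offline.partialSol ν x₀ PC u) c, s.total + g, s.total + g⟩

/-! ### Networks -/

/-- A connected undirected graph with nonnegative edge costs. -/
structure Network (V : Type u) where
  graph : SimpleGraph V
  connected : graph.Connected
  cost : Sym2 V → ℝ
  cost_nonneg : ∀ e, 0 ≤ cost e

namespace Network

variable {V : Type u} (N : Network V)

/-- Shortest path distance. -/
def dist (x y : V) : ℝ := ⨅ w : N.graph.Walk x y, (w.edges.map N.cost).sum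

/-! ### Steiner tree -/

/-- `x` and `y` are connected via the edges in `S`. -/
def Joined (S : Finset (Sym2 V)) (x y : V) : Prop :=
  (SimpleGraph.fromEdgeSet (S : Set (Sym2 V))).Reachable x y

/-- Cost of an optimal Steiner tree for the terminals `T` with root `ρ`. -/
def steinerOpt (ρ : V) (T : Finset V) : ℝ :=
  sInf {t : ℝ | ∃ S : Finset (Sym2 V), (∀ e ∈ S, e ∈ N.graph.edgeSet) ∧
    (∀ x ∈ T, Joined S x ρ) ∧ t = ∑ e ∈ S, N.cost e}

open Classical in
/-- The prize-collecting Steiner tree problem with root `ρ` for the predicted terminals. -/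
def steinerPC (ρ : V) (Rhat : List V) :
    PrizeCollecting (Fin Rhat.length) (Finset (Sym2 V)) where
  IsSol S := ∀ e ∈ S, e ∈ N.graph.edgeSet
  cost S := ∑ e ∈ S, N.cost e
  unsat S := Finset.univ.filter fun i => ¬ Joined S (Rhat.get i) ρ

open Classical in
/-- The edges that have to be added to `S` in order to contain the walk `w`. -/
def newEdges (S : Finset (Sym2 V)) {x y : V} (w : N.graph.Walk x y) : Finset (Sym2 V) :=
  w.edges.toFinset \ S

/-- The Greedy algorithm: connect `x` to the root via a shortest path, where the edges bought
already have cost zero; `S'` is the new set of bought edges, and `g` is the price of the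
added edges. -/
def GreedyStep (ρ : V) (S : Finset (Sym2 V)) (x : V) (S' : Finset (Sym2 V)) (g : ℝ) : Prop :=
  ∃ w : N.graph.Walk x ρ, w.IsPath ∧
    (∀ w' : N.graph.Walk x ρ, ∑ e ∈ N.newEdges S w, N.cost e ≤ ∑ e ∈ N.newEdges S w', N.cost e) ∧
    (∀ e, e ∈ S' ↔ e ∈ S ∨ e ∈ N.newEdges S w) ∧ g = ∑ e ∈ N.newEdges S w, N.cost e

open Classical in
/-- The learning-augmented algorithm for online Steiner tree; a configuration is the set of
bought edges. -/
def steinerAlg (ρ : V) (Rhat : List V) :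
    Components (Fin Rhat.length) (Finset (Sym2 V)) (Finset (Sym2 V)) V where
  offline := N.steinerPC ρ Rhat
  start := ∅
  on := N.GreedyStep ρ
  buy T S := S ∪ T

open Classical in
/-- Cost of the hyperedge formed by the requests `A'` (positions in `R₁`) and `b` (a position in
`R₂`): an optimal Steiner tree for the terminals `A'` with root `b`. -/
def steinerγ (R₁ R₂ : List V) (A' : Finset (Fin R₁.length)) (b : Fin R₂.length) : ℝ :=
  N.steinerOpt (R₂.get b) (A'.image R₁.get)

/-- The cover error for Steiner tree. -/
def steinerError (k : ℕ) (R Rhat : List V) : ℝ≥0∞ :=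
  coverValue (sumCost (N.steinerγ Rhat R)) ⊤ + coverValue (sumCost (N.steinerγ R Rhat)) (k : ℕ∞)

end Network

/-! ### Facility location -/

namespace Facility

variable {V : Type u}

/-- A solution in which not all clients need be connected. -/
structure PartialAssignment (ι : Type*) (V : Type u) where
  opened : Finset V
  assign : ι → Option V

/-- Configuration of an online algorithm: the open facilities, the clients that arrived since the
latest restart, and all connections (client, facility) made so far. -/
structure Config (V : Type u) where
  opened : Finset V
  clients : List V
  conns : List (V × V)

/- In this block, `f v` is the cost for opening a facility at `v`, and `κ v x` is the cost for
connecting the client `x` to a facility at `v`. -/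
variable (f : V → ℝ) (κ : V → V → ℝ)

/-- The optimal cost of opening facilities and connecting every client of `R` to one of them. -/
def opt (R : List V) : ℝ :=
  sInf {t : ℝ | ∃ (F : Finset V) (a : Fin R.length → V), (∀ i, a i ∈ F) ∧
    t = ∑ v ∈ F, f v + ∑ i, κ (a i) (R.get i)}

open Classical in
/-- The prize-collecting facility location problem for the predicted clients. -/
def pc (Rhat : List V) :
    PrizeCollecting (Fin Rhat.length) (PartialAssignment (Fin Rhat.length) V) where
  IsSol S := ∀ i v, S.assign i = some v → v ∈ S.opened
  cost S := ∑ v ∈ S.opened, f v + ∑ i, (S.assign i).elim 0 fun v => κ v (Rhat.get i)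
  unsat S := Finset.univ.filter fun i => S.assign i = none

open Classical in
/-- Connection cost of the client `x` to the closest facility in `F`
(used for nonempty `F` only). -/
def toSet (F : Finset V) (x : V) : ℝ :=
  if h : F.Nonempty then F.inf' h fun v => κ v x else 0

/-- Potential of a facility at `z`: what the earlier clients would save if it were opened. -/
def potential (s : Config V) (z : V) : ℝ :=
  (s.clients.map fun y => max 0 (toSet κ s.opened y - κ z y)).sum

/-- The value of the dual variable of the arriving client `x` at which the bids for opening a
facility at `z` would pay for its opening cost. -/
def threshold (s : Config V) (x z : V) : ℝ := f z - potential κ s z + κ z x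

/-- `v` is a facility in `F` that is closest to `x`. -/
def IsClosest (F : Finset V) (x v : V) : Prop := v ∈ F ∧ ∀ z ∈ F, κ v x ≤ κ z x

open Classical in
/-- The primal-dual algorithm of Fotakis. The dual variable of the arriving client `x` is raised
from zero. If it reaches the distance to the closest open facility first, then no facility is
opened; if it reaches a threshold first, then the corresponding facility is opened. After that,
the client is connected to the closest open facility. -/
inductive Step (s : Config V) (x : V) : Config V → ℝ → Prop
  | stay (v : V) : IsClosest κ s.opened x v → (∀ z, κ v x ≤ threshold f κ s x z) →
      Step s x ⟨s.opened, x :: s.clients, (x, v) :: s.conns⟩ (κ v x)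
  | add (w v : V) : w ∉ s.opened → (∀ z, threshold f κ s x w ≤ threshold f κ s x z) →
      (∀ z ∈ s.opened, threshold f κ s x w ≤ κ z x) →
      IsClosest κ (insert w s.opened) x v →
      Step s x ⟨insert w s.opened, x :: s.clients, (x, v) :: s.conns⟩ (f w + κ v x)

open Classical in
/-- The learning-augmented algorithm for online facility location. -/
def alg (Rhat : List V) :
    Components (Fin Rhat.length) (PartialAssignment (Fin Rhat.length) V) (Config V) V where
  offline := pc f κ Rhat
  start := ⟨∅, [], []⟩
  on := Step f κ
  buy T s := ⟨s.opened ∪ T.opened, [], s.conns⟩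

/-- Opening and connection cost of a configuration. -/
def configCost (s : Config V) : ℝ :=
  ∑ v ∈ s.opened, f v + (s.conns.map fun p => κ p.2 p.1).sum

/-- Cost of the hyperedge formed by the clients `A'` and `b`: open a facility at `b` and assign
the clients `A'` to it. -/
def γ (R₁ R₂ : List V) (A' : Finset (Fin R₁.length)) (b : Fin R₂.length) : ℝ :=
  f (R₂.get b) + ∑ a ∈ A', κ (R₂.get b) (R₁.get a)

/-- The cover error for facility location. -/
def coverError (k : ℕ) (R Rhat : List V) : ℝ≥0∞ :=
  coverValue (refinedCost (fun b => f (R.get b)) (γ f κ Rhat R)) ⊤ +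
    coverValue (refinedCost (fun b => f (Rhat.get b)) (γ f κ R Rhat)) (k : ℕ∞)

/-! ### Soft-capacitated facility location -/

/- Here `d` is the distance and `β v` is the capacity of each facility opened at `v`. -/
variable (d : V → V → ℝ) (β : V → ℕ)

open Classical in
/-- The optimal cost of opening `m v` facilities at every vertex `v` and connecting every client
of `R`, subject to the capacities. -/
def capOpt [Fintype V] (R : List V) : ℝ :=
  sInf {t : ℝ | ∃ (m : V → ℕ) (a : Fin R.length → V),
    (∀ v, (Finset.univ.filter fun i => a i = v).card ≤ m v * β v) ∧
    t = ∑ v, f v * m v + ∑ i, d (a i) (R.get i)}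

/-- The connection costs of the uncapacitated instance to which a soft-capacitated instance is
reduced: each client also pays its share `f v / β v` of the opening cost. -/
def capκ (v x : V) : ℝ := d v x + f v / β v

open Classical in
/-- Number of clients connected to `v`. -/
def load (s : Config V) (v : V) : ℕ := (s.conns.filter fun p => p.2 = v).length

/-- Cost of a configuration of the uncapacitated algorithm as a soft-capacitated solution: a first
facility is opened at `v` when `v` is opened, and a further one whenever a client is connected to
`v` and all facilities there are full. -/
def capConfigCost (s : Config V) : ℝ :=
  ∑ v ∈ s.opened, f v * (max 1 ⌈(load s v : ℝ) / β v⌉₊ : ℕ) +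
    (s.conns.map fun p => d p.2 p.1).sum

/-- Cost of the hyperedge formed by the clients `A'` and `b`: open as many facilities at `b` as
are needed for the clients `A'`, and assign them to these. -/
def capγ (R₁ R₂ : List V) (A' : Finset (Fin R₁.length)) (b : Fin R₂.length) : ℝ :=
  f (R₂.get b) * (⌈(A'.card : ℝ) / β (R₂.get b)⌉₊ : ℕ) + ∑ a ∈ A', d (R₂.get b) (R₁.get a)

/-- The cover error for soft-capacitated facility location. -/
def capCoverError (k : ℕ) (R Rhat : List V) : ℝ≥0∞ :=
  coverValue (refinedCost (fun b => f (R.get b)) (capγ f d β Rhat R)) ⊤ +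
    coverValue (refinedCost (fun b => f (Rhat.get b)) (capγ f d β R Rhat)) (k : ℕ∞)

end Facility

/-- The value `C · OPT + C · (1 + log k) · Λ`. -/
def errorBound (C : ℝ) (k : ℕ) (OPT : ℝ) (Λ : ℝ≥0∞) : ℝ≥0∞ :=
  ENNReal.ofReal (C * OPT) + ENNReal.ofReal (C * (1 + Real.log k)) * Λ

end

/-!
Major iterations at least double the online cost, and the solution bought in each of them costs a
constant times the current online cost. The total cost is therefore at most a constant times the
online cost `last` at the latest major iteration.

A cover of `Rhat` by `R` extends an optimal solution for `R` to one that satisfies all predicted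
requests. Once `last` exceeds a constant times its cost, the next major iteration buys `Partial 0`,
and afterwards every predicted request is served. Then a phase of the online algorithm can be
bounded hyperedge by hyperedge of a cover of `R` by `Rhat`. By packing disjoint moats around its
requests, the `j`-th most expensive request of a hyperedge costs Greedy at most `2 / j` of the
Steiner tree of the hyperedge. For the algorithm of Fotakis, the first `j` requests of a hyperedge
bid for a facility at its endpoint, so that the dual variable of the `j`-th one is at most its own
connection cost plus twice a `1 / j` fraction of the hyperedge cost. Hence a hyperedge with at most
`k` requests accounts for a harmonic factor `1 + log k`.

A soft-capacitated instance reduces, with a loss of a factor `2`, to connection costs that include a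
share `f v / β v` of the opening cost.
-/

/-! ### Sums over finite sets -/

theorem sum_union_le_sum_add_sum {α : Type*} [DecidableEq α] (s t : Finset α) {c : α → ℝ}
    (hc : ∀ a, 0 ≤ c a) : ∑ a ∈ s ∪ t, c a ≤ ∑ a ∈ s, c a + ∑ a ∈ t, c a := by
  rw [← Finset.sum_union_inter]
  exact le_add_of_nonneg_right (Finset.sum_nonneg fun a _ => hc a)

theorem sum_biUnion_le_sum_sum {ι α : Type*} [DecidableEq α] (s : Finset ι) (t : ι → Finset α)
    {c : α → ℝ} (hc : ∀ a, 0 ≤ c a) : ∑ a ∈ s.biUnion t, c a ≤ ∑ i ∈ s, ∑ a ∈ t i, c a := by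
  classical
  induction s using Finset.induction_on with
  | empty => simp
  | insert i s hi ih =>
    rw [Finset.biUnion_insert, Finset.sum_insert hi]
    exact (sum_union_le_sum_add_sum _ _ hc).trans (by gcongr)

theorem sum_toFinset_le_sum_map {α : Type*} [DecidableEq α] (l : List α) {c : α → ℝ}
    (hc : ∀ a, 0 ≤ c a) : ∑ a ∈ l.toFinset, c a ≤ (l.map c).sum := by
  have hdedup : l.toFinset = l.dedup.toFinset := by ext; simp
  rw [hdedup, List.sum_toFinset _ l.nodup_dedup]
  refine ((List.dedup_sublist l).map c).sum_le_sum fun x hx => ?_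
  obtain ⟨a, -, rfl⟩ := List.mem_map.1 hx
  exact hc a

theorem harmonic_cast_nonneg (m : ℕ) : (0 : ℝ) ≤ (harmonic m : ℝ) := by
  rw [harmonic]
  push_cast
  positivity

theorem harmonic_le_one_add_log_of_le {m k : ℕ} (hm : m ≤ k) :
    (harmonic m : ℝ) ≤ 1 + Real.log k := by
  rcases Nat.eq_zero_or_pos m with rfl | hpos
  · have := Real.log_natCast_nonneg k
    rw [harmonic_zero, Rat.cast_zero]
    linarith
  · refine (harmonic_le_one_add_log m).trans ?_
    gcongr

theorem sum_le_mul_harmonic {ι : Type*} {g : ι → ℝ} {G : ℝ} (hG : 0 ≤ G) (s : Finset ι)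
    (h : ∀ P ⊆ s, P.Nonempty → ∀ c, 0 < c → (∀ i ∈ P, c ≤ g i) → ((P.card : ℝ) + 1) * c ≤ G) :
    ∑ i ∈ s, g i ≤ G * (harmonic s.card : ℝ) := by
  classical
  induction s using Finset.strongInduction with
  | H s ih =>
    rcases s.eq_empty_or_nonempty with rfl | hne
    · simp
    · obtain ⟨i, hi, hmin⟩ := s.exists_min_image g hne
      have hrest := ih (s.erase i) (Finset.erase_ssubset hi) fun P hP =>
        h P (hP.trans (Finset.erase_subset _ _))
      have hcard : s.card = (s.erase i).card + 1 := (Finset.card_erase_add_one hi).symm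
      have hgi : g i ≤ G * ((s.card : ℝ))⁻¹ := by
        rcases le_or_gt (g i) 0 with h0 | h0
        · exact h0.trans (by positivity)
        · have := h s subset_rfl hne (g i) h0 hmin
          rw [← div_eq_mul_inv, le_div_iff₀ (by exact_mod_cast hne.card_pos)]
          linarith
      rw [hcard] at hgi
      rw [← Finset.add_sum_erase s g hi, hcard, harmonic_succ]
      push_cast at hgi ⊢
      rw [mul_add]
      linarith

/-! ### Windows of requests -/

/-- The positions `m, …, n - 1` of a sequence of `N` requests. They are elements of `Fin N`, so that
they can be used both for looking up requests and as endpoints of hyperedges. -/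
def window {N : ℕ} (m n : ℕ) : Finset (Fin N) := {i | m ≤ (i : ℕ) ∧ (i : ℕ) < n}

section Window

variable {N : ℕ}

theorem mem_window {m n : ℕ} {i : Fin N} : i ∈ window m n ↔ m ≤ (i : ℕ) ∧ (i : ℕ) < n := by
  simp [window]

theorem window_self (m : ℕ) : (window m m : Finset (Fin N)) = ∅ := by
  ext i
  simp only [mem_window, Finset.notMem_empty, iff_false]
  omega

theorem notMem_window_self (m : ℕ) (i : Fin N) : i ∉ window m (i : ℕ) := by
  simp [mem_window]

theorem window_succ {m : ℕ} {i : Fin N} (hi : m ≤ (i : ℕ)) :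
    window m ((i : ℕ) + 1) = Finset.cons i (window m (i : ℕ)) (notMem_window_self m i) := by
  ext j
  rw [Finset.mem_cons, mem_window, mem_window, Fin.ext_iff]
  omega

theorem sum_window_succ {m : ℕ} {i : Fin N} (hi : m ≤ (i : ℕ)) (g : Fin N → ℝ) :
    ∑ j ∈ window m ((i : ℕ) + 1), g j = ∑ j ∈ window m (i : ℕ), g j + g i := by
  rw [window_succ hi, Finset.sum_cons, add_comm]

theorem window_induction {m n : ℕ} (hn : n ≤ N) {Q : ℕ → Prop} (base : Q m)
    (step : ∀ i : Fin N, i ∈ window m n → Q i → Q (i + 1)) : ∀ j, m ≤ j → j ≤ n → Q j := by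
  intro j hmj
  induction j, hmj using Nat.le_induction with
  | base => exact fun _ => base
  | succ j hmj ih =>
    intro hj
    exact step ⟨j, by omega⟩ (mem_window.2 ⟨hmj, hj⟩) (ih (by omega))

end Window

/-! ### Partial solutions -/

namespace PrizeCollecting

variable {ι Sol : Type*} {P : PrizeCollecting ι Sol} {ν x₀ : ℝ} {PC : (ι → ℝ) → Sol}

/-- `S` is an offline solution that satisfies all predicted requests. Such a solution pays no
penalties, so it is what the outputs of `PC` are compared with. -/
def IsComplete (P : PrizeCollecting ι Sol) (S : Sol) : Prop := P.IsSol S ∧ P.unsat S = ∅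

theorem exists_partialSol_eq_uniform (hx : 0 < x₀) (u : ℕ) :
    ∃ x : ℝ, 0 ≤ x ∧ P.partialSol ν x₀ PC u = PC fun _ => x := by
  unfold partialSol
  split_ifs
  · exact ⟨0, le_rfl, rfl⟩
  · exact ⟨_, by positivity, rfl⟩

theorem IsApprox.isSol_partialSol (h : P.IsApprox ν PC) (hx : 0 < x₀) (u : ℕ) :
    P.IsSol (P.partialSol ν x₀ PC u) := by
  obtain ⟨x, hx0, he⟩ := exists_partialSol_eq_uniform (P := P) (ν := ν) (PC := PC) hx u
  rw [he]
  exact (h _ fun _ => hx0).1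

theorem IsApprox.cost_add_card_mul_le (h : P.IsApprox ν PC) {S : Sol} (hS : P.IsComplete S)
    {x : ℝ} (hx : 0 ≤ x) :
    P.cost (PC fun _ => x) + (P.unsat (PC fun _ => x)).card * x ≤ ν * P.cost S := by
  simpa [pcCost, hS.2] using (h (fun _ => x) fun _ => hx).2 S hS.1

theorem IsApprox.cost_partialSol_le (h : P.IsApprox ν PC) (hx : 0 < x₀) {S : Sol}
    (hS : P.IsComplete S) (u : ℕ) : P.cost (P.partialSol ν x₀ PC u) ≤ ν * P.cost S := by
  obtain ⟨x, hx0, he⟩ := exists_partialSol_eq_uniform (P := P) (ν := ν) (PC := PC) hx u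
  rw [he]
  exact le_of_add_le_of_nonneg_left (h.cost_add_card_mul_le hS hx0) (by positivity)

theorem LeavesFew.unsat_eq_empty {x : ℝ} (h : P.LeavesFew ν PC 0 x) :
    P.unsat (PC fun _ => x) = ∅ := by
  simpa [LeavesFew] using h

theorem IsApprox.exists_leavesFew_zero (h : P.IsApprox ν PC) (hx : 0 < x₀)
    (hcost : ∀ S, 0 ≤ P.cost S) {S : Sol} (hS : P.IsComplete S) :
    ∃ n : ℕ, P.LeavesFew ν PC 0 (x₀ * 2 ^ n) := by
  obtain ⟨n, hn⟩ := pow_unbounded_of_one_lt (ν * P.cost S / x₀) (one_lt_two (α := ℝ))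
  rw [div_lt_iff₀' hx] at hn
  refine ⟨n, ?_⟩
  have hle := h.cost_add_card_mul_le hS (x := x₀ * 2 ^ n) (by positivity)
  have hcard : ((P.unsat (PC fun _ => x₀ * 2 ^ n)).card : ℝ) < 1 := by
    by_contra! hone
    have := mul_le_mul_of_nonneg_right hone (by positivity : 0 ≤ x₀ * 2 ^ n)
    linarith [hcost (PC fun _ => x₀ * 2 ^ n)]
  have hzero := Nat.cast_lt_one.1 hcard
  simp [LeavesFew, hzero]

theorem IsApprox.isComplete_partialSol_zero (h : P.IsApprox ν PC) (hx : 0 < x₀)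
    (hcost : ∀ S, 0 ≤ P.cost S) {S : Sol} (hS : P.IsComplete S) :
    P.IsComplete (P.partialSol ν x₀ PC 0) := by
  refine ⟨h.isSol_partialSol hx 0, ?_⟩
  unfold partialSol
  split_ifs with h0
  · exact h0.unsat_eq_empty
  · exact (Nat.sInf_mem (s := {n : ℕ | P.LeavesFew ν PC 0 (x₀ * 2 ^ n)})
      (h.exists_leavesFew_zero hx hcost hS)).unsat_eq_empty

theorem IsApprox.exists_isLeast_cost_le [Finite ι] (h : P.IsApprox ν PC) (hν : 1 ≤ ν)
    {S : Sol} (hS : P.IsSol S) (hcost : P.cost S ≤ 0) {t : ℝ} (ht : 0 ≤ t) :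
    ∃ u, IsLeast {u : ℕ | P.cost (P.partialSol ν x₀ PC u) ≤ t} u := by
  have := Fintype.ofFinite ι
  have hfew : P.LeavesFew ν PC (Fintype.card ι) 0 := by
    have hcard : ((P.unsat (PC fun _ => 0)).card : ℝ) ≤ Fintype.card ι := by
      exact_mod_cast Finset.card_le_univ _
    unfold LeavesFew
    nlinarith [Nat.cast_nonneg (α := ℝ) (Fintype.card ι)]
  have hle : P.cost (PC fun _ => 0) ≤ ν * P.cost S := by
    simpa [pcCost] using (h (fun _ => 0) fun _ => le_rfl).2 S hS
  have hmem : P.cost (P.partialSol ν x₀ PC (Fintype.card ι)) ≤ t := by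
    rw [partialSol, if_pos hfew]
    nlinarith
  exact ⟨_, Nat.sInf_mem ⟨_, hmem⟩, fun u hu => Nat.sInf_le hu⟩

theorem IsApprox.isComplete_of_isLeast (h : P.IsApprox ν PC) (hν : 0 ≤ ν) (hx : 0 < x₀)
    (hcost : ∀ S, 0 ≤ P.cost S) {S : Sol} (hS : P.IsComplete S) {t : ℝ} (ht : P.cost S ≤ 3 * t)
    {u : ℕ} (hu : IsLeast {u : ℕ | P.cost (P.partialSol ν x₀ PC u) ≤ 3 * ν * t} u) :
    P.IsComplete (P.partialSol ν x₀ PC u) := by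
  have hzero : P.cost (P.partialSol ν x₀ PC 0) ≤ 3 * ν * t := by
    calc P.cost (P.partialSol ν x₀ PC 0) ≤ ν * P.cost S := h.cost_partialSol_le hx hS 0
      _ ≤ ν * (3 * t) := by gcongr
      _ = 3 * ν * t := by ring
  rw [Nat.le_zero.1 (hu.2 hzero)]
  exact h.isComplete_partialSol_zero hx hcost hS

end PrizeCollecting

/-! ### Phases between major iterations -/

section Framework

variable {ι Sol Cfg Req : Type*} {A : Components ι Sol Cfg Req}

/-- The configurations that arise from the start by serving requests online and by buying offline
solutions, in any order. They carry the invariants of the online algorithm. -/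
inductive Components.Reachable (A : Components ι Sol Cfg Req) : Cfg → Prop
  | start : A.Reachable A.start
  | on {c c' : Cfg} {r : Req} {g : ℝ} : A.Reachable c → A.on c r c' g → A.Reachable c'
  | buy {c : Cfg} {S : Sol} : A.Reachable c → A.offline.IsSol S → A.Reachable (A.buy S c)

/-- The reachable configurations from which the online algorithm is started or restarted. -/
inductive Components.IsInitial (A : Components ι Sol Cfg Req) : Cfg → Prop
  | start : A.IsInitial A.start
  | buy {c : Cfg} {S : Sol} : A.Reachable c → A.offline.IsSol S → A.IsInitial (A.buy S c)

theorem Components.IsInitial.reachable {c : Cfg} (h : A.IsInitial c) : A.Reachable c := by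
  cases h with
  | start => exact .start
  | buy hc hS => exact hc.buy hS

/-- The online algorithm, started at an initial configuration, serves the requests at the positions
`m, …, n - 1` of `R` one after the other: `cs i` is the configuration before the request at
position `i`, and `g i` is the price for serving it. -/
structure IsPhase (A : Components ι Sol Cfg Req) (R : List Req) (m n : ℕ) (cs : ℕ → Cfg)
    (g : Fin R.length → ℝ) : Prop where
  isInitial : A.IsInitial (cs m)
  le : m ≤ n
  le_length : n ≤ R.length
  on : ∀ i ∈ window m n, A.on (cs (i : ℕ)) (R.get i) (cs ((i : ℕ) + 1)) (g i)

namespace IsPhase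

variable {R : List Req} {m n : ℕ} {cs : ℕ → Cfg} {g : Fin R.length → ℝ}

theorem nil {c : Cfg} (hc : A.IsInitial c) (hm : m ≤ R.length) :
    IsPhase A R m m (fun _ => c) g :=
  ⟨hc, le_rfl, hm, fun i hi => by simp [window_self] at hi⟩

theorem reachable (h : IsPhase A R m n cs g) : ∀ i, m ≤ i → i ≤ n → A.Reachable (cs i) :=
  window_induction h.le_length h.isInitial.reachable fun i hi hr => hr.on (h.on i hi)

theorem snoc {i : Fin R.length} {c : Cfg} {g₀ : ℝ} (h : IsPhase A R m i cs g)
    (hon : A.on (cs (i : ℕ)) (R.get i) c g₀) :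
    IsPhase A R m ((i : ℕ) + 1) (Function.update cs ((i : ℕ) + 1) c)
      (Function.update g i g₀) := by
  have hmi := h.le
  have hcs : ∀ j ≤ (i : ℕ), Function.update cs ((i : ℕ) + 1) c j = cs j := fun j hj =>
    Function.update_of_ne (by omega) _ _
  refine ⟨by rw [hcs m hmi]; exact h.isInitial, by omega, i.2, fun j hj => ?_⟩
  rw [window_succ hmi, Finset.mem_cons] at hj
  rcases hj with rfl | hj
  · simpa [hcs] using hon
  · have hlt := (mem_window.1 hj).2
    rw [hcs j hlt.le, hcs (j + 1) hlt, Function.update_of_ne (Fin.ne_of_lt hlt)]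
    exact h.on j hj

theorem exists_snoc {P : List Req} {r : Req} {c : Cfg} {g₀ : ℝ} (hP : P ++ [r] <+: R)
    (h : IsPhase A R m P.length cs g) (hon : A.on (cs P.length) r c g₀) :
    ∃ (hlen : P.length < R.length) (cs' : ℕ → Cfg) (g' : Fin R.length → ℝ),
      IsPhase A R m (P.length + 1) cs' g' ∧ cs' m = cs m ∧ cs' (P.length + 1) = c ∧
      ∑ i ∈ window m P.length, g' i = ∑ i ∈ window m P.length, g i ∧
      g' ⟨P.length, hlen⟩ = g₀ := by
  have hlen : P.length < R.length := by simpa using hP.length_le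
  have hr : R.get ⟨P.length, hlen⟩ = r := by
    simpa using (hP.getElem (i := P.length) (by simp)).symm
  have hm := h.le
  exact ⟨hlen, _, _, h.snoc (i := ⟨P.length, hlen⟩) (by rwa [hr]),
    Function.update_of_ne (by dsimp only; omega) _ _, Function.update_self ..,
    Finset.sum_update_of_notMem (notMem_window_self m ⟨P.length, hlen⟩) _ _,
    Function.update_self ..⟩

end IsPhase

namespace Run

variable {ν x₀ : ℝ} {PC : (ι → ℝ) → Sol} {R : List Req} {s : FrameworkState Cfg}

theorem reachable (hx : 0 < x₀) (hPC : A.offline.IsApprox ν PC) (h : Run A ν x₀ PC R s) :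
    A.Reachable s.cfg := by
  induction h with
  | nil => exact .start
  | minor _ hon _ ih => exact ih.on hon
  | major _ hon _ _ ih => exact (ih.on hon).buy (hPC.isSol_partialSol hx _)

theorem last_le_total_le (hg : ∀ c r c' g, A.on c r c' g → 0 ≤ g)
    (h : Run A ν x₀ PC R s) : 0 ≤ s.last ∧ s.last ≤ s.total ∧ s.total ≤ 2 * s.last := by
  induction h with
  | nil => simp
  | minor _ hon hlt ih =>
    have := hg _ _ _ _ hon
    exact ⟨ih.1, by dsimp only; linarith, hlt.le⟩
  | major _ hon _ _ ih =>
    have := hg _ _ _ _ hon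
    exact ⟨by dsimp only; linarith, le_rfl, by dsimp only; linarith⟩

theorem exists_of_isApprox [Finite ι] (hν : 1 ≤ ν) (hx : 0 < x₀)
    (hPC : A.offline.IsApprox ν PC) {S : Sol} (hS : A.offline.IsSol S)
    (hcost : A.offline.cost S ≤ 0) (hon : ∀ c r, A.Reachable c → ∃ c' g, A.on c r c' g)
    (hg : ∀ c r c' g, A.on c r c' g → 0 ≤ g) (R : List Req) :
    ∃ s, Run A ν x₀ PC R s := by
  induction R using List.reverseRecOn with
  | nil => exact ⟨_, .nil⟩
  | append_singleton R r ih =>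
    obtain ⟨s, hs⟩ := ih
    obtain ⟨c, g, hc⟩ := hon s.cfg r (hs.reachable hx hPC)
    rcases lt_or_ge (s.total + g) (2 * s.last) with hlt | hge
    · exact ⟨_, hs.minor hc hlt⟩
    · have hlast := (hs.last_le_total_le hg).1
      have htotal : 0 ≤ s.total + g := by linarith
      obtain ⟨u, hu⟩ := hPC.exists_isLeast_cost_le (x₀ := x₀) hν hS hcost
        (t := 3 * ν * (s.total + g)) (by positivity)
      exact ⟨_, hs.major hc hge hu⟩

theorem cost_le_mul_last (hν : 0 ≤ ν) {W : Cfg → ℝ} (hstart : W A.start ≤ 0)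
    (hon : ∀ c r c' g, A.on c r c' g → W c' ≤ W c + g)
    (hbuy : ∀ c S, W (A.buy S c) ≤ W c + A.offline.cost S)
    (hg : ∀ c r c' g, A.on c r c' g → 0 ≤ g) (h : Run A ν x₀ PC R s) :
    W s.cfg ≤ (2 + 6 * ν) * s.last := by
  suffices W s.cfg ≤ s.total + 6 * ν * s.last by linarith [(h.last_le_total_le hg).2.2]
  induction h with
  | nil => simpa using hstart
  | minor _ hc _ ih =>
    dsimp only
    linarith [hon _ _ _ _ hc]
  | @major _ s _ c g u _ hc hge hu ih =>
    have hpartial : A.offline.cost (A.offline.partialSol ν x₀ PC u) ≤ 3 * ν * (s.total + g) :=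
      hu.1
    have hdouble : ν * (2 * s.last) ≤ ν * (s.total + g) := by gcongr
    have := hon _ _ _ _ hc
    have := hbuy c (A.offline.partialSol ν x₀ PC u)
    dsimp only
    linarith

theorem exists_phase (hx : 0 < x₀) (hPC : A.offline.IsApprox ν PC) {P : List Req}
    (h : Run A ν x₀ PC P s) (hP : P <+: R) :
    ∃ m cs g, IsPhase A R m P.length cs g ∧ cs P.length = s.cfg ∧
      s.total = s.last + ∑ i ∈ window m P.length, g i ∧
      (s.last = 0 ∨ ∃ c u, cs m = A.buy (A.offline.partialSol ν x₀ PC u) c ∧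
        IsLeast {u | A.offline.cost (A.offline.partialSol ν x₀ PC u) ≤ 3 * ν * s.last} u) := by
  induction h with
  | nil => exact ⟨0, _, fun _ => 0, .nil .start (by simp), rfl, by simp, .inl rfl⟩
  | @minor P s r c g₀ _ hon _ ih =>
    obtain ⟨m, cs, g, hphase, hlast, htotal, hfirst⟩ := ih ((P.prefix_append [r]).trans hP)
    obtain ⟨hlen, cs', g', hphase', hm, hlast', hold, hnew⟩ :=
      hphase.exists_snoc hP (hlast ▸ hon)
    rw [List.length_append, List.length_singleton]
    refine ⟨m, cs', g', hphase', hlast', ?_, by rwa [hm]⟩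
    rw [sum_window_succ (i := ⟨P.length, hlen⟩) hphase.le, hold, hnew, htotal, add_assoc]
  | major hrun hon _ hu _ =>
    exact ⟨_, _, fun _ => 0, .nil (.buy ((hrun.reachable hx hPC).on hon)
      (hPC.isSol_partialSol hx _)) hP.length_le, rfl, by simp, .inr ⟨_, _, rfl, hu⟩⟩

theorem last_le (hν : 0 ≤ ν) (hx : 0 < x₀) (hPC : A.offline.IsApprox ν PC)
    (hcost : ∀ S, 0 ≤ A.offline.cost S) (hg : ∀ c r c' g, A.on c r c' g → 0 ≤ g)
    {S : Sol} (hS : A.offline.IsComplete S) {O Y : ℝ} (hO : 0 ≤ O) (hY : 0 ≤ Y)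
    (hstep : ∀ {m cs g} (i : Fin R.length), m ≤ (i : ℕ) → IsPhase A R m ((i : ℕ) + 1) cs g →
      g i ≤ O + ∑ j ∈ window m (i : ℕ), g j)
    (hphase : ∀ {m n cs g c T}, IsPhase A R m n cs g → cs m = A.buy T c →
      A.offline.IsComplete T → A.offline.cost T ≤ ν * A.offline.cost S →
      ∑ i ∈ window m n, g i ≤ Y)
    (h : Run A ν x₀ PC R s) : s.last ≤ 2 * Y + A.offline.cost S + O := by
  have hS0 := hcost S
  suffices ∀ {P s}, Run A ν x₀ PC P s → P <+: R → s.last ≤ 2 * Y + A.offline.cost S + O from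
    this h List.prefix_rfl
  intro P s hrun
  induction hrun with
  | nil => exact fun _ => by dsimp only; linarith
  | minor _ _ _ ih => exact fun hP => ih ((List.prefix_append _ _).trans hP)
  | @major P s r c g₀ u hrun hon hge _ _ =>
    intro hP
    obtain ⟨m, cs, g, hp, hlast, htotal, hfirst⟩ :=
      hrun.exists_phase hx hPC ((P.prefix_append [r]).trans hP)
    obtain ⟨hlen, cs', g', hp', hm, -, hold, hnew⟩ := hp.exists_snoc hP (hlast ▸ hon)
    have hle := hstep ⟨P.length, hlen⟩ hp.le hp'
    have hsum := sum_window_succ (i := ⟨P.length, hlen⟩) hp.le g'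
    obtain ⟨-, -, htwo⟩ := hrun.last_le_total_le hg
    dsimp only at hle hsum ⊢
    rcases hfirst with hzero | ⟨c₀, v, hbuy, hv⟩
    · linarith
    rcases lt_or_ge (3 * s.last) (A.offline.cost S) with hlt | hge'
    · linarith
    · have := hphase hp' (hm.trans hbuy)
        (hPC.isComplete_of_isLeast hν hx hcost hS hge' hv) (hPC.cost_partialSol_le hx hS v)
      linarith

end Run

end Framework

/-! ### Hyperedge covers -/

section Cover

variable {A B : Type*}

theorem IsHyperedgeCover.card_le {k : ℕ} {H : Finset (Finset A × B)}
    (hH : IsHyperedgeCover (k : ℕ∞) H) {h : Finset A × B} (hh : h ∈ H) : h.1.card ≤ k := by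
  exact_mod_cast hH.1 h hh

theorem IsHyperedgeCover.sum_le [DecidableEq A] {k : ℕ∞} {H : Finset (Finset A × B)}
    (hH : IsHyperedgeCover k H) {P : Finset A} {a : A → ℝ} (ha : ∀ p ∈ P, 0 ≤ a p) :
    ∑ p ∈ P, a p ≤ ∑ h ∈ H, ∑ p ∈ h.1 ∩ P, a p := by
  calc ∑ p ∈ P, a p ≤ ∑ p ∈ P, ∑ h ∈ H, if p ∈ h.1 then a p else 0 := by
        refine Finset.sum_le_sum fun p hp => ?_
        obtain ⟨h, hh, hph⟩ := hH.2 p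
        calc a p = if p ∈ h.1 then a p else 0 := (if_pos hph).symm
          _ ≤ _ := Finset.single_le_sum (f := fun h : Finset A × B => if p ∈ h.1 then a p else 0)
            (fun h _ => by split_ifs; exacts [ha p hp, le_rfl]) hh
    _ = ∑ h ∈ H, ∑ p ∈ h.1 ∩ P, a p := by
        rw [Finset.sum_comm]
        simp only [Finset.sum_ite, Finset.sum_const_zero, add_zero, Finset.filter_mem_eq_inter,
          Finset.inter_comm]

theorem exists_coverValue_eq [Finite A] [Finite B] {cost : Finset (Finset A × B) → ℝ} {k : ℕ∞}
    (h : coverValue cost k ≠ ∞) :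
    ∃ H, IsHyperedgeCover k H ∧ coverValue cost k = ENNReal.ofReal (cost H) := by
  have hne : {H : Finset (Finset A × B) | IsHyperedgeCover k H}.Nonempty := by
    by_contra hempty
    refine h (iInf₂_eq_top.2 fun H hH => ?_)
    exact absurd (show H ∈ {H | IsHyperedgeCover k H} from hH)
      (Set.not_nonempty_iff_eq_empty.1 hempty ▸ Set.notMem_empty H)
  obtain ⟨H, hH, hmin⟩ := Set.exists_min_image _ (fun H => ENNReal.ofReal (cost H))
    (Set.toFinite _) hne
  exact ⟨H, hH, le_antisymm (iInf₂_le H hH) (le_iInf₂ hmin)⟩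

theorem ofReal_le_errorBound {A' B' : Type*} [Finite A] [Finite B] [Finite A'] [Finite B']
    {cost₁ : Finset (Finset A × B) → ℝ} {cost₂ : Finset (Finset A' × B') → ℝ} {k : ℕ}
    {C O W : ℝ} (hC : 0 < C)
    (h : ∀ H₁ H₂, IsHyperedgeCover ⊤ H₁ → IsHyperedgeCover (k : ℕ∞) H₂ →
      W ≤ C * (O + (1 + Real.log k) * (cost₁ H₁ + cost₂ H₂))) :
    ENNReal.ofReal W ≤ errorBound C k O (coverValue cost₁ ⊤ + coverValue cost₂ (k : ℕ∞)) := by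
  have hfactor : 0 < C * (1 + Real.log k) := by
    have := Real.log_natCast_nonneg k
    positivity
  by_cases htop : coverValue cost₁ ⊤ + coverValue cost₂ (k : ℕ∞) = ∞
  · rw [errorBound, htop, ENNReal.mul_top (by simpa using hfactor), add_top]
    exact le_top
  · rw [ENNReal.add_eq_top, not_or] at htop
    obtain ⟨H₁, h₁, e₁⟩ := exists_coverValue_eq htop.1
    obtain ⟨H₂, h₂, e₂⟩ := exists_coverValue_eq htop.2
    rw [errorBound, e₁, e₂]
    calc ENNReal.ofReal W
        ≤ ENNReal.ofReal (C * O + C * (1 + Real.log k) * (cost₁ H₁ + cost₂ H₂)) :=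
          ENNReal.ofReal_le_ofReal ((h H₁ H₂ h₁ h₂).trans_eq (by ring))
      _ ≤ ENNReal.ofReal (C * O) +
          ENNReal.ofReal (C * (1 + Real.log k) * (cost₁ H₁ + cost₂ H₂)) := ENNReal.ofReal_add_le
      _ ≤ _ := by
          rw [ENNReal.ofReal_mul hfactor.le]
          gcongr
          exact ENNReal.ofReal_add_le

end Cover

namespace Network

variable {V : Type u} {N : Network V}

/-! ### Shortest path distance -/

theorem walkCost_nonneg {x y : V} (w : N.graph.Walk x y) : 0 ≤ (w.edges.map N.cost).sum :=
  List.sum_nonneg (by simpa using fun e _ => N.cost_nonneg e)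

theorem sum_cost_nonneg (S : Finset (Sym2 V)) : 0 ≤ ∑ e ∈ S, N.cost e :=
  Finset.sum_nonneg fun e _ => N.cost_nonneg e

theorem dist_le {x y : V} (w : N.graph.Walk x y) : N.dist x y ≤ (w.edges.map N.cost).sum :=
  ciInf_le ⟨0, by rintro _ ⟨w, rfl⟩; exact walkCost_nonneg w⟩ w

theorem le_dist {x y : V} {t : ℝ} (h : ∀ w : N.graph.Walk x y, t ≤ (w.edges.map N.cost).sum) :
    t ≤ N.dist x y :=
  haveI : Nonempty (N.graph.Walk x y) := N.connected.preconnected x y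
  le_ciInf h

variable (N) in
theorem dist_nonneg (x y : V) : 0 ≤ N.dist x y := le_dist walkCost_nonneg

variable (N) in
theorem dist_self (x : V) : N.dist x x = 0 :=
  le_antisymm (by simpa using dist_le (N := N) (.nil : N.graph.Walk x x)) (N.dist_nonneg x x)

variable (N) in
theorem dist_comm (x y : V) : N.dist x y = N.dist y x := by
  have hle : ∀ x y, N.dist x y ≤ N.dist y x := fun x y => le_dist fun w => by
    simpa using dist_le w.reverse
  exact le_antisymm (hle x y) (hle y x)

variable (N) in
theorem dist_triangle (x y z : V) : N.dist x z ≤ N.dist x y + N.dist y z := by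
  rw [← sub_le_iff_le_add]
  refine le_dist fun w => ?_
  rw [sub_le_comm]
  refine le_dist fun w' => ?_
  have happend := dist_le (w.append w')
  rw [SimpleGraph.Walk.edges_append, List.map_append, List.sum_append] at happend
  linarith

theorem dist_le_cost {x y : V} (h : N.graph.Adj x y) : N.dist x y ≤ N.cost s(x, y) := by
  simpa using dist_le h.toWalk

/-! ### Connections via bought edges -/

theorem Joined.mono {S T : Finset (Sym2 V)} (h : S ⊆ T) {x y : V} (hj : Joined S x y) :
    Joined T x y :=
  SimpleGraph.Reachable.mono (SimpleGraph.fromEdgeSet_mono (by exact_mod_cast h)) hj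

theorem Joined.exists_walk {S : Finset (Sym2 V)} (hS : ∀ e ∈ S, e ∈ N.graph.edgeSet) {x y : V}
    (hj : Joined S x y) : ∃ w : N.graph.Walk x y, ∀ e ∈ w.edges, e ∈ S := by
  obtain ⟨w⟩ := hj
  have hle : SimpleGraph.fromEdgeSet (S : Set (Sym2 V)) ≤ N.graph := fun a b hab =>
    hS _ ((SimpleGraph.fromEdgeSet_adj _).1 hab).1
  refine ⟨w.mapLe hle, fun e he => ?_⟩
  have hmem := w.edges_subset_edgeSet (by simpa using he)
  rw [SimpleGraph.edgeSet_fromEdgeSet] at hmem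
  exact hmem.1

theorem joined_of_walk {S : Finset (Sym2 V)} {x y : V} (w : N.graph.Walk x y)
    (hw : ∀ e ∈ w.edges, e ∈ S) : Joined S x y := by
  induction w with
  | nil => exact SimpleGraph.Reachable.refl _
  | cons hadj w ih =>
    simp only [SimpleGraph.Walk.edges_cons, List.mem_cons, forall_eq_or_imp] at hw
    refine SimpleGraph.Reachable.trans (SimpleGraph.Adj.reachable ?_) (ih hw.2)
    exact (SimpleGraph.fromEdgeSet_adj _).2 ⟨hw.1, hadj.ne⟩

/-- The absolute difference of the values of a function at the ends of an edge. Its sum over a set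
of edges bounds the difference of the values at any two vertices that the set connects. -/
def variation (φ : V → ℝ) : Sym2 V → ℝ :=
  Sym2.lift ⟨fun x y => |φ x - φ y|, fun _ _ => abs_sub_comm _ _⟩

theorem variation_nonneg (φ : V → ℝ) (e : Sym2 V) : 0 ≤ variation φ e := by
  induction e with
  | _ x y => exact abs_nonneg _

theorem abs_sub_le_sum_map_variation (φ : V → ℝ) {G : SimpleGraph V} {x y : V} (w : G.Walk x y) :
    |φ x - φ y| ≤ (w.edges.map (variation φ)).sum := by
  induction w with
  | nil => simp
  | cons hadj w ih =>
    rw [SimpleGraph.Walk.edges_cons, List.map_cons, List.sum_cons]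
    exact (abs_sub_le _ _ _).trans (add_le_add le_rfl ih)

theorem Joined.abs_sub_le_sum_variation {S : Finset (Sym2 V)} {x y : V} (h : Joined S x y)
    (φ : V → ℝ) : |φ x - φ y| ≤ ∑ e ∈ S, variation φ e := by
  classical
  obtain ⟨w⟩ := h
  refine (abs_sub_le_sum_map_variation φ w.bypass).trans ?_
  rw [← List.sum_toFinset _ w.bypass_isPath.isTrail.edges_nodup]
  refine Finset.sum_le_sum_of_subset_of_nonneg (fun e he => ?_) fun e _ _ => variation_nonneg φ e
  have hmem := w.bypass.edges_subset_edgeSet (List.mem_toFinset.1 he)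
  rw [SimpleGraph.edgeSet_fromEdgeSet] at hmem
  exact hmem.1

/-! ### Separated terminals -/

/-- The moat of width `c / 2` around `p`, encoded as the function that measures how deep inside the
moat a vertex lies. Moats around terminals at distance at least `c` are disjoint, and a tree that
connects the terminals crosses all of them. -/
noncomputable def moat (N : Network V) (c : ℝ) (p v : V) : ℝ := max 0 (c / 2 - N.dist p v)

theorem moat_nonneg (c : ℝ) (p v : V) : 0 ≤ N.moat c p v := le_max_left _ _

theorem moat_self {c : ℝ} (hc : 0 ≤ c) (p : V) : N.moat c p p = c / 2 := by
  rw [moat, dist_self, sub_zero, max_eq_right (by positivity)]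

theorem moat_eq_zero_of_le {c : ℝ} {p v : V} (h : c / 2 ≤ N.dist p v) : N.moat c p v = 0 :=
  max_eq_left (sub_nonpos.2 h)

theorem moat_eq_zero_or {c : ℝ} {p q : V} (h : c ≤ N.dist p q) (v : V) :
    N.moat c p v = 0 ∨ N.moat c q v = 0 := by
  have htri := N.dist_triangle p v q
  rw [N.dist_comm v q] at htri
  rcases le_total (c / 2) (N.dist p v) with hp | hp
  · exact .inl (moat_eq_zero_of_le hp)
  · exact .inr (moat_eq_zero_of_le (by linarith))

theorem abs_moat_sub_moat_le (c : ℝ) (p x y : V) :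
    |N.moat c p x - N.moat c p y| ≤ N.dist x y := by
  have hxy := N.dist_triangle p x y
  have hyx := N.dist_triangle p y x
  rw [N.dist_comm y x] at hyx
  refine (abs_max_sub_max_le_max _ _ _ _).trans (max_le (by simp [N.dist_nonneg]) ?_)
  exact abs_le.2 ⟨by linarith, by linarith⟩

theorem moat_add_moat_le {c : ℝ} {p q x y : V} (h : c ≤ N.dist p q) (hp : N.moat c p y = 0)
    (hq : N.moat c q x = 0) : N.moat c p x + N.moat c q y ≤ N.dist x y := by
  have hpx := (abs_le.1 (abs_moat_sub_moat_le (N := N) c p x y)).2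
  have hqy := (abs_le.1 (abs_moat_sub_moat_le (N := N) c q x y)).1
  have htri := (N.dist_triangle p x q).trans (add_le_add le_rfl (N.dist_triangle x y q))
  rw [N.dist_comm y q] at htri
  rcases max_cases 0 (c / 2 - N.dist p x) with hx | hx <;>
    rcases max_cases 0 (c / 2 - N.dist q y) with hy | hy <;>
    unfold moat at * <;> linarith

section Separated

variable {ι : Type*} {p : ι → V} {c : ℝ}

theorem exists_forall_ne_moat_eq_zero [Nonempty ι]
    (hsep : Pairwise fun i j => c ≤ N.dist (p i) (p j)) (v : V) :
    ∃ i₀, ∀ i, i ≠ i₀ → N.moat c (p i) v = 0 := by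
  by_cases h : ∃ i₀, N.moat c (p i₀) v ≠ 0
  · obtain ⟨i₀, hi₀⟩ := h
    exact ⟨i₀, fun i hi => (moat_eq_zero_or (hsep hi) v).resolve_right hi₀⟩
  · push Not at h
    exact ⟨Classical.arbitrary ι, fun i _ => h i⟩

theorem sum_abs_moat_sub_moat_le [Fintype ι] [Nonempty ι]
    (hsep : Pairwise fun i j => c ≤ N.dist (p i) (p j)) (x y : V) :
    ∑ i, |N.moat c (p i) x - N.moat c (p i) y| ≤ N.dist x y := by
  classical
  obtain ⟨i₀, hi₀⟩ := exists_forall_ne_moat_eq_zero hsep x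
  obtain ⟨j₀, hj₀⟩ := exists_forall_ne_moat_eq_zero hsep y
  have hzero : ∀ i, i ≠ i₀ → i ≠ j₀ → |N.moat c (p i) x - N.moat c (p i) y| = 0 :=
    fun i hi hj => by rw [hi₀ i hi, hj₀ i hj, sub_zero, abs_zero]
  rcases eq_or_ne i₀ j₀ with rfl | hij
  · rw [Fintype.sum_eq_single i₀ fun i hi => hzero i hi hi]
    exact abs_moat_sub_moat_le c (p i₀) x y
  · rw [Fintype.sum_eq_add i₀ j₀ hij fun i hi => hzero i hi.1 hi.2, hj₀ i₀ hij, hi₀ j₀ hij.symm,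
      sub_zero, zero_sub, abs_neg, abs_of_nonneg (moat_nonneg ..), abs_of_nonneg (moat_nonneg ..)]
    exact moat_add_moat_le (hsep hij) (hj₀ i₀ hij) (hi₀ j₀ hij.symm)

theorem card_mul_le_two_mul_sum_cost [Fintype ι] [Nontrivial ι] (hc : 0 ≤ c)
    (hsep : Pairwise fun i j => c ≤ N.dist (p i) (p j)) {S : Finset (Sym2 V)}
    (hS : ∀ e ∈ S, e ∈ N.graph.edgeSet) (hjoined : ∀ i j, Joined S (p i) (p j)) :
    (Fintype.card ι : ℝ) * c ≤ 2 * ∑ e ∈ S, N.cost e := by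
  have hcross : ∀ i, c / 2 ≤ ∑ e ∈ S, variation (N.moat c (p i)) e := by
    intro i
    obtain ⟨j, hji⟩ := exists_ne i
    have hfar : N.moat c (p i) (p j) = 0 :=
      moat_eq_zero_of_le ((half_le_self hc).trans (hsep hji.symm))
    have h := (hjoined i j).abs_sub_le_sum_variation (N.moat c (p i))
    rwa [moat_self hc, hfar, sub_zero, abs_of_nonneg (by positivity)] at h
  have hedge : ∀ e ∈ S, ∑ i, variation (N.moat c (p i)) e ≤ N.cost e := by
    intro e he
    have hadj := hS e he
    induction e with
    | _ x y => exact (sum_abs_moat_sub_moat_le hsep x y).trans (dist_le_cost hadj)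
  have hsum : (Fintype.card ι : ℝ) * (c / 2) ≤ ∑ e ∈ S, N.cost e := by
    calc (Fintype.card ι : ℝ) * (c / 2) = ∑ _ : ι, c / 2 := by simp
      _ ≤ ∑ i, ∑ e ∈ S, variation (N.moat c (p i)) e := Finset.sum_le_sum fun i _ => hcross i
      _ = ∑ e ∈ S, ∑ i, variation (N.moat c (p i)) e := Finset.sum_comm
      _ ≤ ∑ e ∈ S, N.cost e := Finset.sum_le_sum hedge
  linarith

end Separated

/-! ### Optimal Steiner trees -/

variable (N) in
theorem exists_steinerOpt_eq [Finite V] (ρ : V) (T : Finset V) :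
    ∃ S : Finset (Sym2 V), (∀ e ∈ S, e ∈ N.graph.edgeSet) ∧ (∀ x ∈ T, Joined S x ρ) ∧
      N.steinerOpt ρ T = ∑ e ∈ S, N.cost e := by
  classical
  have := Fintype.ofFinite V
  suffices N.steinerOpt ρ T ∈ {t : ℝ | ∃ S : Finset (Sym2 V), (∀ e ∈ S, e ∈ N.graph.edgeSet) ∧
      (∀ x ∈ T, Joined S x ρ) ∧ t = ∑ e ∈ S, N.cost e} from this
  refine Set.Nonempty.csInf_mem ?_ ((Set.finite_range fun S : Finset (Sym2 V) =>
    ∑ e ∈ S, N.cost e).subset ?_)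
  · refine ⟨_, Finset.univ.filter fun e => e ∈ N.graph.edgeSet, by simp, fun x _ => ?_, rfl⟩
    obtain ⟨w⟩ := N.connected.preconnected x ρ
    exact joined_of_walk w fun e he => by simpa using w.edges_subset_edgeSet he
  · rintro t ⟨S, -, -, rfl⟩
    exact ⟨S, rfl⟩

variable (N) in
theorem steinerOpt_nonneg (ρ : V) (T : Finset V) : 0 ≤ N.steinerOpt ρ T := by
  refine Real.sInf_nonneg ?_
  rintro t ⟨S, -, -, rfl⟩
  exact sum_cost_nonneg S

theorem sumCost_steinerγ_nonneg (R₁ R₂ : List V)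
    (H : Finset (Finset (Fin R₁.length) × Fin R₂.length)) : 0 ≤ sumCost (N.steinerγ R₁ R₂) H :=
  Finset.sum_nonneg fun _ _ => N.steinerOpt_nonneg _ _

/-! ### Greedy -/

theorem mem_newEdges {S : Finset (Sym2 V)} {x y : V} {w : N.graph.Walk x y} {e : Sym2 V} :
    e ∈ N.newEdges S w ↔ e ∈ w.edges ∧ e ∉ S := by
  simp [newEdges]

variable (N) in
theorem exists_greedyStep [Finite V] (ρ : V) (S : Finset (Sym2 V)) (x : V) :
    ∃ S' g, N.GreedyStep ρ S x S' g := by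
  classical
  obtain ⟨w₀⟩ := N.connected.preconnected x ρ
  obtain ⟨_, ⟨w, rfl⟩, hmin⟩ := Set.exists_min_image
    (Set.range fun w : N.graph.Walk x ρ => N.newEdges S w) (fun T => ∑ e ∈ T, N.cost e)
    (Set.toFinite _) ⟨_, w₀, rfl⟩
  refine ⟨S ∪ N.newEdges S w.bypass, _, w.bypass, w.bypass_isPath, fun w' => ?_,
    fun e => Finset.mem_union, rfl⟩
  refine le_trans ?_ (hmin _ ⟨w', rfl⟩)
  refine Finset.sum_le_sum_of_subset_of_nonneg (fun e he => ?_) fun e _ _ => N.cost_nonneg e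
  rw [mem_newEdges] at he ⊢
  exact ⟨w.edges_bypass_subset_edges he.1, he.2⟩

namespace GreedyStep

variable {ρ x : V} {S S' : Finset (Sym2 V)} {g : ℝ}

theorem nonneg (h : N.GreedyStep ρ S x S' g) : 0 ≤ g := by
  obtain ⟨w, -, -, -, rfl⟩ := h
  exact sum_cost_nonneg _

theorem subset (h : N.GreedyStep ρ S x S' g) : S ⊆ S' := by
  obtain ⟨w, -, -, hS', rfl⟩ := h
  exact fun e he => (hS' e).2 (.inl he)

theorem mem_edgeSet (h : N.GreedyStep ρ S x S' g) (hS : ∀ e ∈ S, e ∈ N.graph.edgeSet) :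
    ∀ e ∈ S', e ∈ N.graph.edgeSet := by
  obtain ⟨w, -, -, hS', rfl⟩ := h
  intro e he
  rcases (hS' e).1 he with he | he
  · exact hS e he
  · exact w.edges_subset_edgeSet (mem_newEdges.1 he).1

theorem joined (h : N.GreedyStep ρ S x S' g) : Joined S' x ρ := by
  obtain ⟨w, -, -, hS', rfl⟩ := h
  refine joined_of_walk w fun e he => (hS' e).2 ?_
  rw [mem_newEdges]
  tauto

theorem sum_cost_le (h : N.GreedyStep ρ S x S' g) :
    ∑ e ∈ S', N.cost e ≤ ∑ e ∈ S, N.cost e + g := by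
  classical
  obtain ⟨w, -, -, hS', rfl⟩ := h
  have hunion : S' = S ∪ N.newEdges S w := by
    ext e
    rw [hS', Finset.mem_union]
  rw [hunion]
  exact sum_union_le_sum_add_sum _ _ N.cost_nonneg

theorem le_dist (h : N.GreedyStep ρ S x S' g) (hS : ∀ e ∈ S, e ∈ N.graph.edgeSet) {y : V}
    (hy : Joined S y ρ) : g ≤ N.dist x y := by
  classical
  obtain ⟨w, -, hmin, -, rfl⟩ := h
  obtain ⟨w₂, hw₂⟩ := hy.exists_walk hS
  refine Network.le_dist fun w₁ => ?_
  have hsub : N.newEdges S (w₁.append w₂) ⊆ w₁.edges.toFinset := by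
    intro e he
    rw [mem_newEdges, SimpleGraph.Walk.edges_append, List.mem_append] at he
    exact List.mem_toFinset.2 (he.1.resolve_right fun h₂ => he.2 (hw₂ e h₂))
  calc ∑ e ∈ N.newEdges S w, N.cost e ≤ ∑ e ∈ N.newEdges S (w₁.append w₂), N.cost e := hmin _
    _ ≤ ∑ e ∈ w₁.edges.toFinset, N.cost e :=
      Finset.sum_le_sum_of_subset_of_nonneg hsub fun e _ _ => N.cost_nonneg e
    _ ≤ (w₁.edges.map N.cost).sum := sum_toFinset_le_sum_map _ N.cost_nonneg

theorem le_sum_cost (h : N.GreedyStep ρ S x S' g) {T : Finset (Sym2 V)}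
    (hT : ∀ e ∈ T, e ∈ N.graph.edgeSet) (hx : Joined T x ρ) : g ≤ ∑ e ∈ T, N.cost e := by
  obtain ⟨w, -, hmin, -, rfl⟩ := h
  obtain ⟨w₂, hw₂⟩ := hx.exists_walk hT
  exact (hmin w₂).trans (Finset.sum_le_sum_of_subset_of_nonneg
    (fun e he => hw₂ e (mem_newEdges.1 he).1) fun e _ _ => N.cost_nonneg e)

end GreedyStep

-- The `j` requests of cost at least `c` are separated by `c` from each other and from `b`, so that
-- a Steiner tree for them crosses `j + 1` disjoint moats.
theorem sum_le_two_mul_steinerOpt_mul_harmonic [Finite V] {ι : Type*} [LinearOrder ι] {r : ι → V}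
    {P : Finset ι} {b : V} {g : ι → ℝ} (hroot : ∀ i ∈ P, g i ≤ N.dist (r i) b)
    (hprev : ∀ i ∈ P, ∀ j ∈ P, j < i → g i ≤ N.dist (r i) (r j)) {T : Finset V}
    (hT : ∀ i ∈ P, r i ∈ T) :
    ∑ i ∈ P, g i ≤ 2 * N.steinerOpt b T * (harmonic P.card : ℝ) := by
  refine sum_le_mul_harmonic (mul_nonneg two_pos.le (N.steinerOpt_nonneg b T)) P ?_
  intro Q hQ hne c hc hg
  obtain ⟨S, hS, hjoined, hcost⟩ := N.exists_steinerOpt_eq b T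
  have : Nonempty Q := hne.to_subtype
  let p : Option Q → V := fun o => o.elim b fun i => r i
  have hroot' : ∀ i : Q, c ≤ N.dist (r i) b := fun i => (hg i i.2).trans (hroot i (hQ i.2))
  have hprev' : ∀ i j : Q, j < i → c ≤ N.dist (r i) (r j) := fun i j hji =>
    (hg i i.2).trans (hprev i (hQ i.2) j (hQ j.2) hji)
  have hsep : Pairwise fun o o' => c ≤ N.dist (p o) (p o') := by
    rintro (_ | i) (_ | j) hij
    · exact absurd rfl hij
    · exact (hroot' j).trans_eq (N.dist_comm _ _)
    · exact hroot' i
    · rcases lt_or_gt_of_ne (fun h => hij (congrArg some h) : i ≠ j) with hlt | hlt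
      · exact (hprev' j i hlt).trans_eq (N.dist_comm _ _)
      · exact hprev' i j hlt
  have hb : ∀ o, Joined S (p o) b := by
    rintro (_ | i)
    · exact SimpleGraph.Reachable.refl _
    · exact hjoined _ (hT i (hQ i.2))
  rw [hcost]
  simpa using card_mul_le_two_mul_sum_cost hc.le hsep hS fun o o' => (hb o).trans (hb o').symm

section SteinerAlg

variable {ρ : V} {R Rhat : List V}

theorem mem_edgeSet_of_reachable {S : Finset (Sym2 V)} (h : (N.steinerAlg ρ Rhat).Reachable S) :
    ∀ e ∈ S, e ∈ N.graph.edgeSet := by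
  classical
  induction h with
  | start => simp [steinerAlg]
  | on _ hon ih => exact GreedyStep.mem_edgeSet hon ih
  | buy _ hT ih => exact fun e he => (Finset.mem_union.1 he).elim (ih e) (hT e)

theorem joined_of_isComplete {S : Finset (Sym2 V)} (h : (N.steinerPC ρ Rhat).IsComplete S)
    (i : Fin Rhat.length) : Joined S (Rhat.get i) ρ := by
  classical
  simpa using Finset.filter_eq_empty_iff.1 h.2 (Finset.mem_univ i)

theorem subset_of_isPhase {m n : ℕ} {cs : ℕ → Finset (Sym2 V)} {g : Fin R.length → ℝ}
    (h : IsPhase (N.steinerAlg ρ Rhat) R m n cs g) {i j : ℕ} (hmi : m ≤ i) (hij : i ≤ j)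
    (hjn : j ≤ n) : cs i ⊆ cs j := by
  refine window_induction (Q := fun j => cs i ⊆ cs j) h.le_length subset_rfl (fun l hl hsub => ?_)
    j hij hjn
  have hl := mem_window.1 hl
  exact hsub.trans (GreedyStep.subset (h.on l (mem_window.2 ⟨by omega, hl.2⟩)))

theorem sum_window_le_of_isPhase [Finite V] {m n : ℕ} {cs : ℕ → Finset (Sym2 V)}
    {g : Fin R.length → ℝ} (h : IsPhase (N.steinerAlg ρ Rhat) R m n cs g)
    (hhat : ∀ i, Joined (cs m) (Rhat.get i) ρ) {k : ℕ}
    {H : Finset (Finset (Fin R.length) × Fin Rhat.length)} (hH : IsHyperedgeCover (k : ℕ∞) H) :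
    ∑ i ∈ window m n, g i ≤ 2 * (1 + Real.log k) * sumCost (N.steinerγ R Rhat) H := by
  classical
  have hdist : ∀ i ∈ window m n, ∀ y, Joined (cs (i : ℕ)) y ρ → g i ≤ N.dist (R.get i) y := by
    intro i hi y hy
    have hi' := mem_window.1 hi
    exact GreedyStep.le_dist (h.on i hi)
      (mem_edgeSet_of_reachable (h.reachable i hi'.1 hi'.2.le)) hy
  rw [sumCost, Finset.mul_sum]
  refine (hH.sum_le fun i hi => GreedyStep.nonneg (h.on i hi)).trans
    (Finset.sum_le_sum fun e he => ?_)
  have hedge : ∑ i ∈ e.1 ∩ window m n, g i ≤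
      2 * N.steinerγ R Rhat e.1 e.2 * (harmonic (e.1 ∩ window m n).card : ℝ) := by
    refine sum_le_two_mul_steinerOpt_mul_harmonic (r := R.get) (fun i hi => ?_)
      (fun i hi j hj hji => ?_) fun i hi =>
        Finset.mem_image_of_mem _ (Finset.mem_of_mem_inter_left hi)
    · have hi := Finset.mem_of_mem_inter_right hi
      have hi' := mem_window.1 hi
      exact hdist i hi _ ((hhat e.2).mono (subset_of_isPhase h le_rfl hi'.1 hi'.2.le))
    · have hi := Finset.mem_of_mem_inter_right hi
      have hj := Finset.mem_of_mem_inter_right hj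
      have hj' := mem_window.1 hj
      exact hdist i hi _ ((GreedyStep.joined (h.on j hj)).mono
        (subset_of_isPhase h (by omega) hji (mem_window.1 hi).2.le))
  have hharmonic := harmonic_le_one_add_log_of_le
    ((Finset.card_le_card Finset.inter_subset_left).trans (hH.card_le he) :
      (e.1 ∩ window m n).card ≤ k)
  have hγ : 0 ≤ N.steinerγ R Rhat e.1 e.2 := N.steinerOpt_nonneg _ _
  calc _ ≤ 2 * N.steinerγ R Rhat e.1 e.2 * (harmonic (e.1 ∩ window m n).card : ℝ) := hedge
    _ ≤ 2 * N.steinerγ R Rhat e.1 e.2 * (1 + Real.log k) := by gcongr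
    _ = 2 * (1 + Real.log k) * N.steinerγ R Rhat e.1 e.2 := by ring

theorem exists_isComplete_cost_le [Finite V] {X : Finset V} (hX : ∀ x ∈ R, x ∈ X)
    {H : Finset (Finset (Fin Rhat.length) × Fin R.length)} (hH : IsHyperedgeCover ⊤ H) :
    ∃ S, (N.steinerPC ρ Rhat).IsComplete S ∧ (N.steinerPC ρ Rhat).cost S ≤
      N.steinerOpt ρ X + sumCost (N.steinerγ Rhat R) H := by
  classical
  obtain ⟨T, hT, hTjoined, hTcost⟩ := N.exists_steinerOpt_eq ρ X
  choose F hF hFjoined hFcost using fun h : Finset (Fin Rhat.length) × Fin R.length =>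
    N.exists_steinerOpt_eq (R.get h.2) (h.1.image Rhat.get)
  refine ⟨T ∪ H.biUnion F, ⟨fun e he => ?_, ?_⟩, ?_⟩
  · rcases Finset.mem_union.1 he with he | he
    · exact hT e he
    · obtain ⟨h, -, he⟩ := Finset.mem_biUnion.1 he
      exact hF h e he
  · refine Finset.filter_eq_empty_iff.2 fun i _ => not_not.2 ?_
    obtain ⟨h, hh, hi⟩ := hH.2 i
    have htree : Joined (F h) (Rhat.get i) (R.get h.2) :=
      hFjoined h _ (Finset.mem_image_of_mem _ hi)
    have hroot : Joined T (R.get h.2) ρ := hTjoined _ (hX _ (List.get_mem _ _))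
    exact (htree.mono ((Finset.subset_biUnion_of_mem F hh).trans
      Finset.subset_union_right)).trans (hroot.mono Finset.subset_union_left)
  · calc ∑ e ∈ T ∪ H.biUnion F, N.cost e
        ≤ ∑ e ∈ T, N.cost e + ∑ e ∈ H.biUnion F, N.cost e :=
          sum_union_le_sum_add_sum _ _ N.cost_nonneg
      _ ≤ ∑ e ∈ T, N.cost e + ∑ h ∈ H, ∑ e ∈ F h, N.cost e := by
          gcongr
          exact sum_biUnion_le_sum_sum _ _ N.cost_nonneg
      _ = N.steinerOpt ρ X + sumCost (N.steinerγ Rhat R) H := by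
          rw [hTcost]
          exact congrArg _ (Finset.sum_congr rfl fun h _ => (hFcost h).symm)

variable {ν x₀ : ℝ} {PC : (Fin Rhat.length → ℝ) → Finset (Sym2 V)} {X : Finset V}

theorem exists_run_steinerAlg [Finite V] (hν : 1 ≤ ν) (hx : 0 < x₀)
    (hPC : (N.steinerPC ρ Rhat).IsApprox ν PC) (R : List V) :
    ∃ s, Run (N.steinerAlg ρ Rhat) ν x₀ PC R s :=
  Run.exists_of_isApprox (A := N.steinerAlg ρ Rhat) (S := ∅) hν hx hPC
    (by simp [steinerAlg, steinerPC]) (by simp [steinerAlg, steinerPC])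
    (fun c r _ => N.exists_greedyStep ρ c r) (fun _ _ _ _ => GreedyStep.nonneg) R

theorem last_le_of_run_steinerAlg [Finite V] (hν : 0 ≤ ν) (hx : 0 < x₀)
    (hPC : (N.steinerPC ρ Rhat).IsApprox ν PC) (hX : ∀ x ∈ R, x ∈ X)
    {s : FrameworkState (Finset (Sym2 V))}
    (h : Run (N.steinerAlg ρ Rhat) ν x₀ PC R s) {k : ℕ}
    {H₁ : Finset (Finset (Fin Rhat.length) × Fin R.length)} (hH₁ : IsHyperedgeCover ⊤ H₁)
    {H₂ : Finset (Finset (Fin R.length) × Fin Rhat.length)}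
    (hH₂ : IsHyperedgeCover (k : ℕ∞) H₂) :
    s.last ≤ 2 * N.steinerOpt ρ X + sumCost (N.steinerγ Rhat R) H₁ +
      4 * (1 + Real.log k) * sumCost (N.steinerγ R Rhat) H₂ := by
  classical
  have := Real.log_natCast_nonneg k
  have hcost₂ := sumCost_steinerγ_nonneg (N := N) R Rhat H₂
  obtain ⟨S, hS, hcost⟩ := exists_isComplete_cost_le (N := N) (ρ := ρ) hX hH₁
  obtain ⟨T, hT, hjoined, hTcost⟩ := N.exists_steinerOpt_eq ρ X
  have hlast := h.last_le hν hx hPC (fun _ => sum_cost_nonneg _)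
    (fun _ _ _ _ => GreedyStep.nonneg) hS (N.steinerOpt_nonneg ρ X)
    (Y := 2 * (1 + Real.log k) * sumCost (N.steinerγ R Rhat) H₂) (by positivity)
    (fun {m cs g} i hmi hphase => ?_) (fun {m n cs g c S'} hphase hbuy hS' _ => ?_)
  · change s.last ≤ _ + (N.steinerPC ρ Rhat).cost S + _ at hlast
    linarith
  · have hstep := GreedyStep.le_sum_cost (hphase.on i (mem_window.2 ⟨hmi, Nat.lt_succ_self _⟩)) hT
      (hjoined _ (hX _ (List.get_mem _ _)))
    have hprev : 0 ≤ ∑ j ∈ window m (i : ℕ), g j := Finset.sum_nonneg fun j hj =>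
      GreedyStep.nonneg (hphase.on j (by rw [window_succ hmi]; exact Finset.mem_cons_of_mem hj))
    linarith
  · refine sum_window_le_of_isPhase hphase (fun i => ?_) hH₂
    rw [hbuy]
    exact (joined_of_isComplete hS' i).mono Finset.subset_union_right

theorem sum_cost_le_of_run_steinerAlg [Finite V] (hν : 0 ≤ ν) (hx : 0 < x₀)
    (hPC : (N.steinerPC ρ Rhat).IsApprox ν PC) (hX : ∀ x ∈ R, x ∈ X)
    {s : FrameworkState (Finset (Sym2 V))}
    (h : Run (N.steinerAlg ρ Rhat) ν x₀ PC R s) {k : ℕ}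
    {H₁ : Finset (Finset (Fin Rhat.length) × Fin R.length)} (hH₁ : IsHyperedgeCover ⊤ H₁)
    {H₂ : Finset (Finset (Fin R.length) × Fin Rhat.length)}
    (hH₂ : IsHyperedgeCover (k : ℕ∞) H₂) :
    ∑ e ∈ s.cfg, N.cost e ≤ (2 + 6 * ν) * (2 * N.steinerOpt ρ X +
      sumCost (N.steinerγ Rhat R) H₁ +
      4 * (1 + Real.log k) * sumCost (N.steinerγ R Rhat) H₂) := by
  classical
  calc ∑ e ∈ s.cfg, N.cost e ≤ (2 + 6 * ν) * s.last :=
        h.cost_le_mul_last hν (W := fun c => ∑ e ∈ c, N.cost e) (by simp [steinerAlg])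
          (fun _ _ _ _ => GreedyStep.sum_cost_le)
          (fun _ _ => sum_union_le_sum_add_sum _ _ N.cost_nonneg)
          (fun _ _ _ _ => GreedyStep.nonneg)
    _ ≤ _ := by
        gcongr
        exact last_le_of_run_steinerAlg hν hx hPC hX h hH₁ hH₂

end SteinerAlg

end Network

/-! ### Covers with a single covered element -/

section SplitCost

variable {A B : Type*}

open Classical in
/-- The hyperedges that are nonempty and whose endpoint in `B` does not cover exactly one element.
The refined cost of a cover pays in full for these. -/
noncomputable def properEdges (H : Finset (Finset A × B)) : Finset (Finset A × B) :=
  H.filter fun h => (coveredBy H h.2).card ≠ 1 ∧ h.1.Nonempty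

open Classical in
/-- The endpoints in `B` that cover exactly one element. The refined cost of a cover does not pay
for opening a facility at these. -/
noncomputable def singleEndpoints [Fintype B] (H : Finset (Finset A × B)) : Finset B :=
  Finset.univ.filter fun b => (coveredBy H b).card = 1

/-- Cost of a cover where an endpoint in `B` that covers exactly one element is charged only for
the distance `d`, and every proper hyperedge for opening and for connecting at cost `κ`. -/
noncomputable def splitCost [Fintype B] (f : B → ℝ) (κ d : B → A → ℝ)
    (H : Finset (Finset A × B)) : ℝ :=
  ∑ b ∈ singleEndpoints H, ∑ p ∈ coveredBy H b, d b p +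
    ∑ h ∈ properEdges H, (f h.2 + ∑ p ∈ h.1, κ h.2 p)

variable {H : Finset (Finset A × B)}

theorem mem_coveredBy {b : B} {p : A} : p ∈ coveredBy H b ↔ ∃ h ∈ H, h.2 = b ∧ p ∈ h.1 := by
  simp [coveredBy, and_assoc]

theorem mem_properEdges {h : Finset A × B} :
    h ∈ properEdges H ↔ h ∈ H ∧ (coveredBy H h.2).card ≠ 1 ∧ h.1.Nonempty := by
  simp [properEdges]

theorem mem_singleEndpoints [Fintype B] {b : B} :
    b ∈ singleEndpoints H ↔ (coveredBy H b).card = 1 := by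
  simp [singleEndpoints]

theorem sum_singleEndpoints_add_le_sum [Fintype B] {f : B → ℝ} {d : B → A → ℝ}
    {γ : Finset A → B → ℝ} (hd : ∀ b p, 0 ≤ d b p) (hγ : ∀ A' b, 0 ≤ γ A' b)
    (hγd : ∀ A' b, A'.Nonempty → f b + ∑ p ∈ A', d b p ≤ γ A' b) :
    ∑ b ∈ singleEndpoints H, (f b + ∑ p ∈ coveredBy H b, d b p) ≤
      ∑ h ∈ H with (coveredBy H h.2).card = 1, γ h.1 h.2 := by
  classical
  rw [← Finset.sum_fiberwise_of_maps_to (g := Prod.snd) (t := singleEndpoints H)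
    fun h hh => mem_singleEndpoints.2 (Finset.mem_filter.1 hh).2]
  refine Finset.sum_le_sum fun b hb => ?_
  obtain ⟨p, hp⟩ := Finset.card_eq_one.1 (mem_singleEndpoints.1 hb)
  obtain ⟨h, hh, rfl, hph⟩ := mem_coveredBy.1 (hp ▸ Finset.mem_singleton_self p)
  rw [hp, Finset.sum_singleton]
  calc f h.2 + d h.2 p ≤ f h.2 + ∑ q ∈ h.1, d h.2 q := by
        gcongr
        exact Finset.single_le_sum (fun q _ => hd h.2 q) hph
    _ ≤ γ h.1 h.2 := hγd h.1 h.2 ⟨p, hph⟩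
    _ ≤ _ := Finset.single_le_sum (f := fun e : Finset A × B => γ e.1 e.2)
      (fun e _ => hγ e.1 e.2) (by simp [hh, mem_singleEndpoints.1 hb])

theorem sum_properEdges_le_sum {f : B → ℝ} {κ : B → A → ℝ} {γ : Finset A → B → ℝ} {c : ℝ}
    (hc : 0 ≤ c) (hγ : ∀ A' b, 0 ≤ γ A' b)
    (hγκ : ∀ A' b, A'.Nonempty → f b + ∑ p ∈ A', κ b p ≤ c * γ A' b) :
    ∑ h ∈ properEdges H, (f h.2 + ∑ p ∈ h.1, κ h.2 p) ≤
      c * ∑ h ∈ H with ¬ (coveredBy H h.2).card = 1, γ h.1 h.2 := by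
  rw [Finset.mul_sum]
  refine (Finset.sum_le_sum fun h hh => hγκ h.1 h.2 (mem_properEdges.1 hh).2.2).trans
    (Finset.sum_le_sum_of_subset_of_nonneg (fun h hh => ?_) fun h _ _ => mul_nonneg hc (hγ _ _))
  obtain ⟨hH, hcard, -⟩ := mem_properEdges.1 hh
  exact Finset.mem_filter.2 ⟨hH, hcard⟩

theorem splitCost_nonneg [Fintype B] {f : B → ℝ} {κ d : B → A → ℝ} (hf : ∀ b, 0 ≤ f b)
    (hκ : ∀ b p, 0 ≤ κ b p) (hd : ∀ b p, 0 ≤ d b p) : 0 ≤ splitCost f κ d H :=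
  add_nonneg (Finset.sum_nonneg fun b _ => Finset.sum_nonneg fun p _ => hd b p)
    (Finset.sum_nonneg fun _ _ => add_nonneg (hf _) (Finset.sum_nonneg fun p _ => hκ _ p))

theorem splitCost_le_mul_refinedCost [Fintype B] {f : B → ℝ} {κ d : B → A → ℝ}
    {γ : Finset A → B → ℝ} {c : ℝ} (hc : 1 ≤ c) (hd : ∀ b p, 0 ≤ d b p)
    (hγ : ∀ A' b, 0 ≤ γ A' b) (hγd : ∀ A' b, A'.Nonempty → f b + ∑ p ∈ A', d b p ≤ γ A' b)
    (hγκ : ∀ A' b, A'.Nonempty → f b + ∑ p ∈ A', κ b p ≤ c * γ A' b) :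
    splitCost f κ d H ≤ c * refinedCost f γ H := by
  have hsingle := sum_singleEndpoints_add_le_sum (H := H) hd hγ hγd
  have hproper := sum_properEdges_le_sum (H := H) (zero_le_one.trans hc) hγ hγκ
  have hdist : 0 ≤ ∑ b ∈ singleEndpoints H, ∑ p ∈ coveredBy H b, d b p :=
    Finset.sum_nonneg fun b _ => Finset.sum_nonneg fun p _ => hd b p
  have hrefined : refinedCost f γ H = ∑ h ∈ H with (coveredBy H h.2).card = 1, γ h.1 h.2 +
      ∑ h ∈ H with ¬ (coveredBy H h.2).card = 1, γ h.1 h.2 - ∑ b ∈ singleEndpoints H, f b := by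
    rw [Finset.sum_filter_add_sum_filter_not]
    rfl
  rw [Finset.sum_add_distrib] at hsingle
  calc splitCost f κ d H ≤ c * ∑ b ∈ singleEndpoints H, ∑ p ∈ coveredBy H b, d b p +
        c * ∑ h ∈ H with ¬ (coveredBy H h.2).card = 1, γ h.1 h.2 :=
        add_le_add (le_mul_of_one_le_left hdist hc) hproper
    _ ≤ c * refinedCost f γ H := by
        rw [← mul_add, hrefined]
        gcongr
        linarith

theorem IsHyperedgeCover.sum_le_of_le_add [Fintype B] [DecidableEq A] {k : ℕ∞}
    (hH : IsHyperedgeCover k H) {P : Finset A} {a : A → ℝ} {d : B → A → ℝ} {c : B → ℝ}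
    (ha : ∀ p, 0 ≤ a p) (hd : ∀ b p, 0 ≤ d b p) (hc : ∀ b, 0 ≤ c b)
    (hle : ∀ b, ∀ p ∈ P, a p ≤ d b p + c b) :
    ∑ p ∈ P, a p ≤ ∑ b ∈ singleEndpoints H, ∑ p ∈ coveredBy H b, d b p + ∑ b, c b +
      ∑ h ∈ properEdges H, ∑ p ∈ h.1 ∩ P, a p := by
  have hsub : P ⊆ (singleEndpoints H).biUnion (fun b => coveredBy H b ∩ P) ∪
      (properEdges H).biUnion fun h => h.1 ∩ P := by
    intro p hp
    obtain ⟨h, hh, hph⟩ := hH.2 p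
    by_cases hcard : (coveredBy H h.2).card = 1
    · exact Finset.mem_union_left _ (Finset.mem_biUnion.2 ⟨h.2, mem_singleEndpoints.2 hcard,
        Finset.mem_inter.2 ⟨mem_coveredBy.2 ⟨h, hh, rfl, hph⟩, hp⟩⟩)
    · exact Finset.mem_union_right _ (Finset.mem_biUnion.2 ⟨h,
        mem_properEdges.2 ⟨hh, hcard, p, hph⟩, Finset.mem_inter.2 ⟨hph, hp⟩⟩)
  have hsingle : ∀ b ∈ singleEndpoints H,
      ∑ p ∈ coveredBy H b ∩ P, a p ≤ ∑ p ∈ coveredBy H b, d b p + c b := by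
    intro b hb
    obtain ⟨p, hp⟩ := Finset.card_eq_one.1 (mem_singleEndpoints.1 hb)
    rw [hp, Finset.sum_singleton]
    by_cases hpP : p ∈ P
    · rw [Finset.singleton_inter_of_mem hpP, Finset.sum_singleton]
      exact hle b p hpP
    · rw [Finset.singleton_inter_of_notMem hpP, Finset.sum_empty]
      exact add_nonneg (hd b p) (hc b)
  calc ∑ p ∈ P, a p ≤ _ := Finset.sum_le_sum_of_subset_of_nonneg hsub fun p _ _ => ha p
    _ ≤ _ := sum_union_le_sum_add_sum _ _ ha
    _ ≤ ∑ b ∈ singleEndpoints H, ∑ p ∈ coveredBy H b ∩ P, a p +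
        ∑ h ∈ properEdges H, ∑ p ∈ h.1 ∩ P, a p := by
        gcongr <;> exact sum_biUnion_le_sum_sum _ _ ha
    _ ≤ ∑ b ∈ singleEndpoints H, (∑ p ∈ coveredBy H b, d b p + c b) +
        ∑ h ∈ properEdges H, ∑ p ∈ h.1 ∩ P, a p := by
        gcongr with b hb
        exact hsingle b hb
    _ ≤ _ := by
        rw [Finset.sum_add_distrib]
        gcongr
        · exact fun b _ _ => hc b
        · exact Finset.subset_univ _

end SplitCost

theorem sum_le_of_forall_card_add_one_mul_le {ι : Type*} [LinearOrder ι] {a κ : ι → ℝ} {F : ℝ}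
    (hκ : ∀ i, 0 ≤ κ i) (P : Finset ι)
    (h : ∀ i ∈ P, ∀ Q ⊆ P, (∀ l ∈ Q, l < i) →
      ((Q.card : ℝ) + 1) * a i ≤ F + ((Q.card : ℝ) + 1) * κ i + 2 * ∑ l ∈ Q, κ l) :
    ∑ i ∈ P, a i ≤ (harmonic P.card : ℝ) * F + (1 + 2 * (harmonic P.card : ℝ)) * ∑ i ∈ P, κ i := by
  induction P using Finset.induction_on_max with
  | empty => simp
  | insert M P hM ih =>
    have hMP : M ∉ P := fun hmem => lt_irrefl _ (hM M hmem)
    have hprev := ih fun i hi Q hQ => h i (Finset.mem_insert_of_mem hi) Q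
      (hQ.trans (Finset.subset_insert _ _))
    have hmax := h M (Finset.mem_insert_self _ _) P (Finset.subset_insert _ _) hM
    have hpos : (0 : ℝ) < (P.card : ℝ) + 1 := by positivity
    have haM : a M ≤ ((P.card : ℝ) + 1)⁻¹ * F + κ M + 2 * ((P.card : ℝ) + 1)⁻¹ * ∑ l ∈ P, κ l := by
      refine le_of_mul_le_mul_left (hmax.trans_eq ?_) hpos
      field_simp
    have hharm := mul_nonneg (harmonic_cast_nonneg P.card) (hκ M)
    have hinv := mul_nonneg (inv_nonneg.2 hpos.le) (hκ M)
    rw [Finset.sum_insert hMP, Finset.sum_insert hMP, Finset.card_insert_of_notMem hMP,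
      harmonic_succ]
    push_cast
    linarith

/-! ### The primal-dual algorithm for facility location -/

namespace Facility

variable {V : Type u} {f : V → ℝ} {κ d : V → V → ℝ}

/-- Connection costs `κ v x` of clients `x` to facilities `v` in a space with distance `d`. They
need not be a metric, so that the costs `capκ` of the soft-capacitated problem are covered, too. -/
structure IsConnectionCost (κ d : V → V → ℝ) : Prop where
  nonneg : ∀ x y, 0 ≤ d x y
  comm : ∀ x y, d x y = d y x
  triangle : ∀ x y z, d x z ≤ d x y + d y z
  le : ∀ v x, d v x ≤ κ v x
  le_add : ∀ v x y, κ v x ≤ κ v y + d y x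

theorem IsConnectionCost.cost_nonneg (h : IsConnectionCost κ d) (v x : V) : 0 ≤ κ v x :=
  (h.nonneg v x).trans (h.le v x)

section ToSet

theorem toSet_le {F : Finset V} {z : V} (hz : z ∈ F) (x : V) : toSet κ F x ≤ κ z x := by
  rw [toSet, dif_pos ⟨z, hz⟩]
  exact Finset.inf'_le _ hz

theorem exists_toSet_eq {F : Finset V} (hF : F.Nonempty) (x : V) :
    ∃ v ∈ F, toSet κ F x = κ v x := by
  rw [toSet, dif_pos hF]
  exact Finset.exists_mem_eq_inf' hF _

theorem exists_isClosest {F : Finset V} (hF : F.Nonempty) (x : V) : ∃ v, IsClosest κ F x v := by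
  obtain ⟨v, hv, h⟩ := exists_toSet_eq (κ := κ) hF x
  exact ⟨v, hv, fun z hz => h ▸ toSet_le hz x⟩

theorem IsClosest.toSet_eq {F : Finset V} {x v : V} (h : IsClosest κ F x v) :
    toSet κ F x = κ v x := by
  obtain ⟨w, hw, heq⟩ := exists_toSet_eq (κ := κ) ⟨v, h.1⟩ x
  exact (toSet_le h.1 x).antisymm (heq ▸ h.2 w hw)

theorem toSet_anti {F F' : Finset V} (hF : F.Nonempty) (h : F ⊆ F') (x : V) :
    toSet κ F' x ≤ toSet κ F x := by
  obtain ⟨w, hw, heq⟩ := exists_toSet_eq (κ := κ) hF x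
  exact heq ▸ toSet_le (h hw) x

theorem toSet_nonneg (hκ : ∀ v x, 0 ≤ κ v x) (F : Finset V) (x : V) : 0 ≤ toSet κ F x := by
  rcases F.eq_empty_or_nonempty with rfl | hF
  · simp [toSet]
  · obtain ⟨w, -, heq⟩ := exists_toSet_eq (κ := κ) hF x
    exact heq ▸ hκ w x

end ToSet

section Potential

/-- Cost for connecting the clients that arrived since the latest restart to the closest open
facilities. It is what is left of the dual variables after paying for the facilities. -/
noncomputable def reconnection (κ : V → V → ℝ) (s : Config V) : ℝ :=
  (s.clients.map (toSet κ s.opened)).sum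

/-- Invariant of the primal-dual algorithm: no facility is overpaid by the clients that arrived
since the latest restart. -/
structure IsFeasible (f : V → ℝ) (κ : V → V → ℝ) (s : Config V) : Prop where
  nonempty : s.clients ≠ [] → s.opened.Nonempty
  potential_le : ∀ z, potential κ s z ≤ f z

theorem potential_cons (F : Finset V) (x : V) (L : List V) (p q : List (V × V)) (z : V) :
    potential κ ⟨F, x :: L, p⟩ z = max 0 (toSet κ F x - κ z x) + potential κ ⟨F, L, q⟩ z :=
  List.sum_cons

theorem reconnection_cons (F : Finset V) (x : V) (L : List V) (p q : List (V × V)) :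
    reconnection κ ⟨F, x :: L, p⟩ = toSet κ F x + reconnection κ ⟨F, L, q⟩ :=
  List.sum_cons

theorem potential_nonneg (s : Config V) (z : V) : 0 ≤ potential κ s z :=
  List.sum_nonneg (by simp)

theorem potential_eq_zero_of_mem {s : Config V} {z : V} (hz : z ∈ s.opened) :
    potential κ s z = 0 :=
  List.sum_eq_zero <| List.forall_mem_map.2 fun y _ =>
    max_eq_left (sub_nonpos.2 (toSet_le hz y))

theorem reconnection_nonneg (hκ : ∀ v x, 0 ≤ κ v x) (s : Config V) : 0 ≤ reconnection κ s :=
  List.sum_nonneg (List.forall_mem_map.2 fun y _ => toSet_nonneg hκ _ y)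

theorem isFeasible_of_clients_eq_nil (hf : ∀ v, 0 ≤ f v) {s : Config V} (hs : s.clients = []) :
    IsFeasible f κ s :=
  ⟨fun h => absurd hs h, fun z => by simpa [potential, hs] using hf z⟩

variable [DecidableEq V] {F : Finset V} {L : List V} {p : List (V × V)}

theorem IsFeasible.toSet_insert_le (hs : IsFeasible f κ ⟨F, L, p⟩) (w : V) {y : V} (hy : y ∈ L) :
    toSet κ (insert w F) y ≤ toSet κ F y :=
  toSet_anti (hs.nonempty (List.ne_nil_of_mem hy)) (Finset.subset_insert _ _) y

theorem IsFeasible.potential_insert_le (hs : IsFeasible f κ ⟨F, L, p⟩) (w z : V) :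
    potential κ ⟨insert w F, L, p⟩ z ≤ potential κ ⟨F, L, p⟩ z :=
  List.sum_le_sum fun _ hy => max_le_max le_rfl (sub_le_sub_right (hs.toSet_insert_le w hy) _)

theorem IsFeasible.potential_add_reconnection_insert_le (hs : IsFeasible f κ ⟨F, L, p⟩) (w : V) :
    potential κ ⟨F, L, p⟩ w + reconnection κ ⟨insert w F, L, p⟩ ≤ reconnection κ ⟨F, L, p⟩ := by
  rw [potential, reconnection, reconnection, ← List.sum_map_add]
  refine List.sum_le_sum fun y hy => ?_
  rw [← le_sub_iff_add_le]
  exact max_le (sub_nonneg.2 (hs.toSet_insert_le w hy))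
    (sub_le_sub_left (toSet_le (Finset.mem_insert_self _ _) y) _)

end Potential

section Step

variable {s s' : Config V} {x : V} {g : ℝ}

/-- `a` is the value at which the dual variable of the arriving client `x` stops in a step of the
primal-dual algorithm: it obeys the dual constraints, and it pays for half of the step. -/
structure IsDual (f : V → ℝ) (κ : V → V → ℝ) (s : Config V) (x : V) (s' : Config V) (g a : ℝ) :
    Prop where
  le_threshold : ∀ z, a ≤ threshold f κ s x z
  le_cost : ∀ z ∈ s.opened, a ≤ κ z x
  add_reconnection_le : g + reconnection κ s' ≤ reconnection κ s + 2 * a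

theorem exists_step [Finite V] [Nonempty V] (hf : ∀ v, 0 ≤ f v) (s : Config V) (x : V) :
    ∃ s' g, Step f κ s x s' g := by
  classical
  obtain ⟨w, hw⟩ := Finite.exists_min (threshold f κ s x)
  obtain ⟨v', hv'⟩ := exists_isClosest (κ := κ) (Finset.insert_nonempty w s.opened) x
  rcases s.opened.eq_empty_or_nonempty with hempty | hne
  · exact ⟨_, _, .add w v' (by simp [hempty]) hw (by simp [hempty]) hv'⟩
  obtain ⟨v, hv⟩ := exists_isClosest (κ := κ) hne x
  rcases le_or_gt (κ v x) (threshold f κ s x w) with hle | hlt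
  · exact ⟨_, _, .stay v hv fun z => hle.trans (hw z)⟩
  refine ⟨_, _, .add w v' (fun hmem => ?_) hw (fun y hy => hlt.le.trans (hv.2 y hy)) hv'⟩
  have := hv.2 w hmem
  have := hf w
  rw [threshold, potential_eq_zero_of_mem hmem] at hlt
  linarith

namespace Step

theorem cost_nonneg (hf : ∀ v, 0 ≤ f v) (hκ : ∀ v x, 0 ≤ κ v x) (h : Step f κ s x s' g) :
    0 ≤ g := by
  cases h with
  | stay v => exact hκ v x
  | add w v => exact add_nonneg (hf w) (hκ v x)

theorem configCost_eq (h : Step f κ s x s' g) : configCost f κ s' = configCost f κ s + g := by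
  classical
  cases h with
  | stay v =>
    simp only [configCost, List.map_cons, List.sum_cons]
    ring
  | add w v hw =>
    simp only [configCost, List.map_cons, List.sum_cons, Finset.sum_insert hw]
    ring

theorem clients_eq (h : Step f κ s x s' g) : s'.clients = x :: s.clients := by
  cases h <;> rfl

theorem opened_subset (h : Step f κ s x s' g) : s.opened ⊆ s'.opened := by
  classical
  cases h with
  | stay v => exact subset_rfl
  | add w v => exact Finset.subset_insert _ _

theorem opened_nonempty (h : Step f κ s x s' g) : s'.opened.Nonempty := by
  cases h with
  | stay v hv => exact ⟨v, hv.1⟩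
  | add w v _ _ _ hv => exact ⟨v, hv.1⟩

theorem isFeasible (hs : IsFeasible f κ s) (h : Step f κ s x s' g) : IsFeasible f κ s' := by
  classical
  refine ⟨fun _ => h.opened_nonempty, fun z => ?_⟩
  have hz := hs.potential_le z
  cases h with
  | stay v hv hle =>
    have hthreshold := hle z
    rw [threshold] at hthreshold
    rw [potential_cons _ _ _ _ s.conns, hv.toSet_eq, ← le_sub_iff_add_le]
    exact max_le (sub_nonneg.2 hz) (by linarith)
  | add w v hw hmin _ hv =>
    have hthreshold := hmin z
    rw [threshold, threshold] at hthreshold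
    have := hs.potential_le w
    have := hs.potential_insert_le w z
    have := hv.2 w (Finset.mem_insert_self _ _)
    rw [potential_cons _ _ _ _ s.conns, hv.toSet_eq, ← le_sub_iff_add_le]
    exact max_le (by linarith) (by linarith)

theorem reconnection_le (hf : ∀ v, 0 ≤ f v) (hs : IsFeasible f κ s) (h : Step f κ s x s' g) :
    reconnection κ s' ≤ reconnection κ s + g := by
  classical
  cases h with
  | stay v hv =>
    rw [reconnection_cons _ _ _ _ s.conns, hv.toSet_eq, add_comm]
  | add w v _ _ _ hv =>
    have := hf w
    have := potential_nonneg (κ := κ) s w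
    have := hs.potential_add_reconnection_insert_le w
    rw [reconnection_cons _ _ _ _ s.conns, hv.toSet_eq]
    linarith

theorem exists_isDual (hκ : ∀ v x, 0 ≤ κ v x) (hs : IsFeasible f κ s) (h : Step f κ s x s' g) :
    ∃ a, 0 ≤ a ∧ IsDual f κ s x s' g a := by
  classical
  cases h with
  | stay v hv hle =>
    refine ⟨κ v x, hκ v x, hle, hv.2, ?_⟩
    rw [reconnection_cons _ _ _ _ s.conns, hv.toSet_eq]
    exact le_of_eq (by ring)
  | add w v _ hmin hle hv =>
    have := hs.potential_le w
    have := hκ w x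
    have := hv.2 w (Finset.mem_insert_self _ _)
    have := potential_nonneg (κ := κ) s w
    have := hs.potential_add_reconnection_insert_le w
    refine ⟨threshold f κ s x w, ?_, hmin, hle, ?_⟩
    · rw [threshold]
      linarith
    · rw [reconnection_cons _ _ _ _ s.conns, hv.toSet_eq, threshold]
      linarith

end Step

end Step

section Phase

variable {R Rhat : List V}

theorem isFeasible_of_reachable (hf : ∀ v, 0 ≤ f v) {c : Config V}
    (h : (alg f κ Rhat).Reachable c) : IsFeasible f κ c := by
  induction h with
  | start => exact isFeasible_of_clients_eq_nil hf rfl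
  | on _ hon ih => exact Step.isFeasible ih hon
  | buy => exact isFeasible_of_clients_eq_nil hf rfl

theorem clients_eq_nil_of_isInitial {c : Config V} (h : (alg f κ Rhat).IsInitial c) :
    c.clients = [] := by
  cases h <;> rfl

variable {m n : ℕ} {cs : ℕ → Config V} {g a : Fin R.length → ℝ}

theorem exists_isDual_of_isPhase (hf : ∀ v, 0 ≤ f v) (hκ : ∀ v x, 0 ≤ κ v x)
    (h : IsPhase (alg f κ Rhat) R m n cs g) :
    ∃ a : Fin R.length → ℝ, (∀ i, 0 ≤ a i) ∧
      ∀ i ∈ window m n, IsDual f κ (cs i) (R.get i) (cs (i + 1)) (g i) (a i) := by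
  have hstep : ∀ i : Fin R.length, ∃ a, 0 ≤ a ∧
      (i ∈ window m n → IsDual f κ (cs i) (R.get i) (cs (i + 1)) (g i) a) := by
    intro i
    by_cases hi : i ∈ window m n
    · have hreach := h.reachable i (mem_window.1 hi).1 (mem_window.1 hi).2.le
      obtain ⟨a, ha₀, ha⟩ := Step.exists_isDual hκ (isFeasible_of_reachable hf hreach) (h.on i hi)
      exact ⟨a, ha₀, fun _ => ha⟩
    · exact ⟨0, le_rfl, fun hi' => absurd hi' hi⟩
  choose a ha₀ ha using hstep
  exact ⟨a, ha₀, ha⟩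

theorem opened_subset_of_isPhase (h : IsPhase (alg f κ Rhat) R m n cs g) {i j : ℕ} (hmi : m ≤ i)
    (hij : i ≤ j) (hjn : j ≤ n) : (cs i).opened ⊆ (cs j).opened :=
  window_induction (m := i) h.le_length (Q := fun j => (cs i).opened ⊆ (cs j).opened) subset_rfl
    (fun l hl ih => ih.trans (Step.opened_subset (h.on l (mem_window.2
      ⟨hmi.trans (mem_window.1 hl).1, (mem_window.1 hl).2⟩)))) j hij hjn

theorem sum_map_clients_of_isPhase (h : IsPhase (alg f κ Rhat) R m n cs g) (φ : V → ℝ) :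
    ∀ j, m ≤ j → j ≤ n → ((cs j).clients.map φ).sum = ∑ i ∈ window m j, φ (R.get i) := by
  refine window_induction h.le_length ?_ fun i hi ih => ?_
  · rw [clients_eq_nil_of_isInitial h.isInitial, window_self, List.map_nil, List.sum_nil,
      Finset.sum_empty]
  · rw [Step.clients_eq (h.on i hi), List.map_cons, List.sum_cons, ih,
      sum_window_succ (mem_window.1 hi).1 fun i => φ (R.get i), add_comm]

theorem reconnection_of_isPhase (h : IsPhase (alg f κ Rhat) R m n cs g) :
    reconnection κ (cs m) = 0 := by
  rw [reconnection, clients_eq_nil_of_isInitial h.isInitial, List.map_nil, List.sum_nil]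

theorem reconnection_le_of_isPhase (hf : ∀ v, 0 ≤ f v)
    (h : IsPhase (alg f κ Rhat) R m n cs g) :
    ∀ j, m ≤ j → j ≤ n → reconnection κ (cs j) ≤ ∑ i ∈ window m j, g i := by
  refine window_induction h.le_length ?_ fun i hi ih => ?_
  · rw [reconnection_of_isPhase h, window_self, Finset.sum_empty]
  · have hi' := mem_window.1 hi
    have := Step.reconnection_le hf
      (isFeasible_of_reachable hf (h.reachable i hi'.1 hi'.2.le)) (h.on i hi)
    rw [sum_window_succ hi'.1]
    linarith

theorem sum_window_add_reconnection_le (h : IsPhase (alg f κ Rhat) R m n cs g)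
    (ha : ∀ i ∈ window m n, IsDual f κ (cs i) (R.get i) (cs (i + 1)) (g i) (a i)) :
    ∀ j, m ≤ j → j ≤ n →
      ∑ i ∈ window m j, g i + reconnection κ (cs j) ≤ 2 * ∑ i ∈ window m j, a i := by
  refine window_induction h.le_length ?_ fun i hi ih => ?_
  · simp [reconnection_of_isPhase h, window_self]
  · have := (ha i hi).add_reconnection_le
    rw [sum_window_succ (mem_window.1 hi).1, sum_window_succ (mem_window.1 hi).1]
    linarith

-- A request `l ∈ Q` was at distance at least `a i - κ b (R.get i) - κ b (R.get l)` from all open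
-- facilities when the request `i` arrived, as otherwise `i` would have had a cheap connection.
theorem sum_sub_le_potential (hκ : IsConnectionCost κ d) (h : IsPhase (alg f κ Rhat) R m n cs g)
    (ha : ∀ i ∈ window m n, IsDual f κ (cs i) (R.get i) (cs (i + 1)) (g i) (a i)) (b : V)
    {i : Fin R.length} (hi : i ∈ window m n) {Q : Finset (Fin R.length)}
    (hQ : Q ⊆ window m (i : ℕ)) :
    ∑ l ∈ Q, (a i - κ b (R.get i) - 2 * κ b (R.get l)) ≤ potential κ (cs i) b := by
  have hi' := mem_window.1 hi
  rw [potential, sum_map_clients_of_isPhase h _ _ hi'.1 hi'.2.le]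
  refine (Finset.sum_le_sum fun l hl => ?_).trans
    (Finset.sum_le_sum_of_subset_of_nonneg hQ fun _ _ _ => le_max_left _ _)
  refine le_max_of_le_right ?_
  obtain ⟨hml, hli⟩ := mem_window.1 (hQ hl)
  have hne : (cs i).opened.Nonempty :=
    (Step.opened_nonempty (h.on l (mem_window.2 ⟨hml, hli.trans hi'.2⟩))).mono
      (opened_subset_of_isPhase h (by omega) hli hi'.2.le)
  obtain ⟨v, hv, heq⟩ := exists_toSet_eq (κ := κ) hne (R.get l)
  have hcost : a i ≤ κ v (R.get l) + d (R.get l) (R.get i) :=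
    ((ha i hi).le_cost v hv).trans (hκ.le_add v (R.get i) (R.get l))
  have htriangle : d (R.get l) (R.get i) ≤ κ b (R.get l) + κ b (R.get i) :=
    calc d (R.get l) (R.get i) ≤ d b (R.get l) + d b (R.get i) :=
          hκ.comm b (R.get l) ▸ hκ.triangle (R.get l) b (R.get i)
      _ ≤ _ := add_le_add (hκ.le _ _) (hκ.le _ _)
  rw [heq]
  linarith

theorem sum_dual_le (hκ : IsConnectionCost κ d) (h : IsPhase (alg f κ Rhat) R m n cs g)
    (ha : ∀ i ∈ window m n, IsDual f κ (cs i) (R.get i) (cs (i + 1)) (g i) (a i)) (b : V)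
    {P : Finset (Fin R.length)} (hP : P ⊆ window m n) :
    ∑ i ∈ P, a i ≤ (harmonic P.card : ℝ) * f b +
      (1 + 2 * (harmonic P.card : ℝ)) * ∑ i ∈ P, κ b (R.get i) := by
  refine sum_le_of_forall_card_add_one_mul_le (fun i => hκ.cost_nonneg b (R.get i)) P
    fun i hi Q hQ hlt => ?_
  have hpotential := sum_sub_le_potential hκ h ha b (hP hi) (Q := Q) fun l hl =>
    mem_window.2 ⟨(mem_window.1 (hP (hQ hl))).1, hlt l hl⟩
  have hthreshold := (ha i (hP hi)).le_threshold b
  rw [threshold] at hthreshold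
  rw [Finset.sum_sub_distrib, Finset.sum_const, nsmul_eq_mul, ← Finset.mul_sum] at hpotential
  linarith

theorem sum_dual_le_one_add_log (hf : ∀ v, 0 ≤ f v) (hκ : IsConnectionCost κ d)
    (h : IsPhase (alg f κ Rhat) R m n cs g)
    (ha : ∀ i ∈ window m n, IsDual f κ (cs i) (R.get i) (cs (i + 1)) (g i) (a i)) (b : V)
    {k : ℕ} {E : Finset (Fin R.length)} (hE : E.card ≤ k) :
    ∑ i ∈ E ∩ window m n, a i ≤ 3 * (1 + Real.log k) * (f b + ∑ i ∈ E, κ b (R.get i)) := by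
  have hlog := Real.log_natCast_nonneg k
  have hharmonic := harmonic_le_one_add_log_of_le
    ((Finset.card_le_card Finset.inter_subset_left).trans hE : (E ∩ window m n).card ≤ k)
  have hκ₀ : ∀ i, 0 ≤ κ b (R.get i) := fun i => hκ.cost_nonneg b (R.get i)
  have hfb := hf b
  have hsum : 0 ≤ ∑ i ∈ E, κ b (R.get i) := Finset.sum_nonneg fun i _ => hκ₀ i
  have : 0 ≤ ∑ i ∈ E ∩ window m n, κ b (R.get i) := Finset.sum_nonneg fun i _ => hκ₀ i
  have hpart : ∑ i ∈ E ∩ window m n, κ b (R.get i) ≤ ∑ i ∈ E, κ b (R.get i) :=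
    Finset.sum_le_sum_of_subset_of_nonneg Finset.inter_subset_left fun i _ _ => hκ₀ i
  have := harmonic_cast_nonneg (E ∩ window m n).card
  calc ∑ i ∈ E ∩ window m n, a i ≤ _ := sum_dual_le hκ h ha b Finset.inter_subset_right
    _ ≤ (1 + Real.log k) * f b + (1 + 2 * (1 + Real.log k)) * ∑ i ∈ E, κ b (R.get i) := by gcongr
    _ ≤ 3 * (1 + Real.log k) * (f b + ∑ i ∈ E, κ b (R.get i)) := by
        nlinarith [mul_nonneg hlog hfb, mul_nonneg hlog hsum]

end Phase

end Facility

/-! ### Facility location along covers -/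

namespace Facility

variable {V : Type u} {f : V → ℝ} {κ d : V → V → ℝ} {R Rhat : List V}

/-- The split cost of a set of hyperedges that connect the clients of `R₁` to facilities at the
locations of the clients of `R₂`. -/
noncomputable def clientSplitCost (f : V → ℝ) (κ d : V → V → ℝ) (R₁ R₂ : List V)
    (H : Finset (Finset (Fin R₁.length) × Fin R₂.length)) : ℝ :=
  splitCost (fun b => f (R₂.get b)) (fun b p => κ (R₂.get b) (R₁.get p))
    (fun b p => d (R₂.get b) (R₁.get p)) H

theorem clientSplitCost_nonneg (hf : ∀ v, 0 ≤ f v) (hκ : IsConnectionCost κ d) (R₁ R₂ : List V)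
    (H : Finset (Finset (Fin R₁.length) × Fin R₂.length)) : 0 ≤ clientSplitCost f κ d R₁ R₂ H :=
  splitCost_nonneg (fun _ => hf _) (fun _ _ => hκ.cost_nonneg _ _) fun _ _ => hκ.nonneg _ _

section Phase

variable {m n : ℕ} {cs : ℕ → Config V} {g a : Fin R.length → ℝ}

-- A client that is alone at `b` pays at most its distance to the predicted client `b` plus the
-- connection cost of `b`, which had an open facility `v b` from the beginning of the phase.
theorem sum_window_dual_le (hf : ∀ v, 0 ≤ f v) (hκ : IsConnectionCost κ d)
    (h : IsPhase (alg f κ Rhat) R m n cs g) (ha₀ : ∀ i, 0 ≤ a i)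
    (ha : ∀ i ∈ window m n, IsDual f κ (cs i) (R.get i) (cs (i + 1)) (g i) (a i))
    {v : Fin Rhat.length → V} (hv : ∀ j, v j ∈ (cs m).opened) {k : ℕ}
    {H : Finset (Finset (Fin R.length) × Fin Rhat.length)} (hH : IsHyperedgeCover (k : ℕ∞) H) :
    ∑ i ∈ window m n, a i ≤ ∑ j, κ (v j) (Rhat.get j) +
      3 * (1 + Real.log k) * clientSplitCost f κ d R Rhat H := by
  have hlog := Real.log_natCast_nonneg k
  have hsplit := hH.sum_le_of_le_add (P := window m n) (d := fun b p => d (Rhat.get b) (R.get p))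
    (c := fun b => κ (v b) (Rhat.get b)) ha₀ (fun _ _ => hκ.nonneg _ _)
    (fun _ => hκ.cost_nonneg _ _) fun b i hi => by
      obtain ⟨hmi, hin⟩ := mem_window.1 hi
      have := (ha i hi).le_cost (v b) (opened_subset_of_isPhase h le_rfl hmi hin.le (hv b))
      have := hκ.le_add (v b) (R.get i) (Rhat.get b)
      linarith
  have hproper : ∑ e ∈ properEdges H, ∑ p ∈ e.1 ∩ window m n, a p ≤ 3 * (1 + Real.log k) *
      ∑ e ∈ properEdges H, (f (Rhat.get e.2) + ∑ p ∈ e.1, κ (Rhat.get e.2) (R.get p)) := by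
    rw [Finset.mul_sum]
    exact Finset.sum_le_sum fun e he =>
      sum_dual_le_one_add_log hf hκ h ha _ (hH.card_le (mem_properEdges.1 he).1)
  have hdist : 0 ≤ ∑ b ∈ singleEndpoints H,
      ∑ p ∈ coveredBy H b, d (Rhat.get b) (R.get p) :=
    Finset.sum_nonneg fun b _ => Finset.sum_nonneg fun p _ => hκ.nonneg _ _
  have := le_mul_of_one_le_left hdist (by linarith : 1 ≤ 3 * (1 + Real.log k))
  rw [clientSplitCost, splitCost, mul_add]
  linarith

theorem sum_window_le_of_isPhase (hf : ∀ v, 0 ≤ f v) (hκ : IsConnectionCost κ d)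
    (h : IsPhase (alg f κ Rhat) R m n cs g) {v : Fin Rhat.length → V}
    (hv : ∀ j, v j ∈ (cs m).opened) {k : ℕ}
    {H : Finset (Finset (Fin R.length) × Fin Rhat.length)} (hH : IsHyperedgeCover (k : ℕ∞) H) :
    ∑ i ∈ window m n, g i ≤ 2 * ∑ j, κ (v j) (Rhat.get j) +
      6 * (1 + Real.log k) * clientSplitCost f κ d R Rhat H := by
  obtain ⟨a, ha₀, ha⟩ := exists_isDual_of_isPhase hf hκ.cost_nonneg h
  have := sum_window_add_reconnection_le h ha n h.le le_rfl
  have := sum_window_dual_le hf hκ h ha₀ ha hv hH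
  have := reconnection_nonneg hκ.cost_nonneg (cs n)
  linarith

end Phase

section Offline

theorem opt_nonneg (hf : ∀ v, 0 ≤ f v) (hκ : ∀ v x, 0 ≤ κ v x) (R : List V) : 0 ≤ opt f κ R := by
  refine Real.sInf_nonneg ?_
  rintro _ ⟨F, a, -, rfl⟩
  exact add_nonneg (Finset.sum_nonneg fun v _ => hf v) (Finset.sum_nonneg fun i _ => hκ _ _)

theorem opt_le (hf : ∀ v, 0 ≤ f v) (hκ : ∀ v x, 0 ≤ κ v x) {F : Finset V}
    {a : Fin R.length → V} (ha : ∀ i, a i ∈ F) :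
    opt f κ R ≤ ∑ v ∈ F, f v + ∑ i, κ (a i) (R.get i) := by
  refine csInf_le ⟨0, ?_⟩ ⟨F, a, ha, rfl⟩
  rintro _ ⟨F', a', -, rfl⟩
  exact add_nonneg (Finset.sum_nonneg fun v _ => hf v) (Finset.sum_nonneg fun i _ => hκ _ _)

theorem exists_opt_eq [Finite V] [Nonempty V] (f : V → ℝ) (κ : V → V → ℝ) (R : List V) :
    ∃ (F : Finset V) (a : Fin R.length → V), (∀ i, a i ∈ F) ∧
      opt f κ R = ∑ v ∈ F, f v + ∑ i, κ (a i) (R.get i) := by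
  have := Fintype.ofFinite V
  refine Set.Nonempty.csInf_mem (s := {t : ℝ | ∃ (F : Finset V) (a : Fin R.length → V),
      (∀ i, a i ∈ F) ∧ t = ∑ v ∈ F, f v + ∑ i, κ (a i) (R.get i)})
    ⟨_, Finset.univ, fun _ => Classical.arbitrary V, fun _ => Finset.mem_univ _, rfl⟩
    ((Set.finite_range fun p : Finset V × (Fin R.length → V) =>
      ∑ v ∈ p.1, f v + ∑ i, κ (p.2 i) (R.get i)).subset ?_)
  rintro _ ⟨F, a, -, rfl⟩
  exact ⟨(F, a), rfl⟩

theorem sum_assign_nonneg (hκ : ∀ v x, 0 ≤ κ v x)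
    (S : PartialAssignment (Fin Rhat.length) V) :
    0 ≤ ∑ i, (S.assign i).elim 0 fun v => κ v (Rhat.get i) := by
  refine Finset.sum_nonneg fun i _ => ?_
  cases S.assign i with
  | none => exact le_rfl
  | some v => exact hκ v _

theorem cost_pc_nonneg (hf : ∀ v, 0 ≤ f v) (hκ : ∀ v x, 0 ≤ κ v x)
    (S : PartialAssignment (Fin Rhat.length) V) : 0 ≤ (pc f κ Rhat).cost S :=
  add_nonneg (Finset.sum_nonneg fun v _ => hf v) (sum_assign_nonneg hκ S)

theorem configCost_buy_le (hf : ∀ v, 0 ≤ f v) (hκ : ∀ v x, 0 ≤ κ v x)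
    (S : PartialAssignment (Fin Rhat.length) V) (s : Config V) :
    configCost f κ ((alg f κ Rhat).buy S s) ≤ configCost f κ s + (pc f κ Rhat).cost S := by
  classical
  have := sum_union_le_sum_add_sum s.opened S.opened hf
  have := sum_assign_nonneg hκ S
  simp only [alg, pc, configCost]
  linarith

theorem exists_assign_of_isComplete {S : PartialAssignment (Fin Rhat.length) V}
    (hS : (pc f κ Rhat).IsComplete S) :
    ∃ v : Fin Rhat.length → V, (∀ j, v j ∈ S.opened) ∧
      (pc f κ Rhat).cost S = ∑ v ∈ S.opened, f v + ∑ j, κ (v j) (Rhat.get j) := by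
  have hassign : ∀ j, ∃ v, S.assign j = some v := fun j =>
    Option.ne_none_iff_exists'.1 (Finset.filter_eq_empty_iff.1 hS.2 (Finset.mem_univ j))
  choose v hv using hassign
  exact ⟨v, fun j => hS.1 j (v j) (hv j), by simp only [pc, hv, Option.elim_some]⟩

-- Open the optimal facilities for `R` and one facility per proper hyperedge: a predicted client
-- that is alone at `b` is connected to the facility that serves `b` in the optimum.
theorem exists_isComplete_cost_le [Finite V] [Nonempty V] (hf : ∀ v, 0 ≤ f v)
    (hκ : IsConnectionCost κ d) {H : Finset (Finset (Fin Rhat.length) × Fin R.length)}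
    (hH : IsHyperedgeCover ⊤ H) :
    ∃ S, (pc f κ Rhat).IsComplete S ∧
      (pc f κ Rhat).cost S ≤ opt f κ R + clientSplitCost f κ d Rhat R H := by
  classical
  obtain ⟨F, a, haF, hopt⟩ := exists_opt_eq f κ R
  set F' : Finset V := F ∪ (properEdges H).image fun h => R.get h.2
  have hclosest : ∀ p : Fin Rhat.length, ∃ v, IsClosest κ F' (Rhat.get p) v := fun p => by
    obtain ⟨h, -, -⟩ := hH.2 p
    exact exists_isClosest ⟨a h.2, Finset.mem_union_left _ (haF _)⟩ _
  choose v hv using hclosest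
  refine ⟨⟨F', fun p => some (v p)⟩, ⟨fun p w hw => ?_, by simp [pc]⟩, ?_⟩
  · exact Option.some.inj hw ▸ (hv p).1
  have hopened : ∑ w ∈ F', f w ≤ ∑ w ∈ F, f w + ∑ h ∈ properEdges H, f (R.get h.2) :=
    (sum_union_le_sum_add_sum _ _ hf).trans
      (by gcongr; exact Finset.sum_image_le_of_nonneg fun _ _ => hf _)
  have hsplit := hH.sum_le_of_le_add (P := Finset.univ) (a := fun p => κ (v p) (Rhat.get p))
    (d := fun b p => d (R.get b) (Rhat.get p)) (c := fun b => κ (a b) (R.get b))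
    (fun _ => hκ.cost_nonneg _ _) (fun _ _ => hκ.nonneg _ _) (fun _ => hκ.cost_nonneg _ _)
    fun b p _ => by
      have := (hv p).2 (a b) (Finset.mem_union_left _ (haF b))
      have := hκ.le_add (a b) (Rhat.get p) (R.get b)
      linarith
  have hproper : ∑ h ∈ properEdges H, ∑ p ∈ h.1, κ (v p) (Rhat.get p) ≤
      ∑ h ∈ properEdges H, ∑ p ∈ h.1, κ (R.get h.2) (Rhat.get p) :=
    Finset.sum_le_sum fun h hh => Finset.sum_le_sum fun p _ =>
      (hv p).2 _ (Finset.mem_union_right _ (Finset.mem_image_of_mem _ hh))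
  simp only [Finset.inter_univ] at hsplit
  simp only [pc, Option.elim_some, clientSplitCost, splitCost, Finset.sum_add_distrib]
  linarith

end Offline

/-! ### The learning-augmented algorithm for facility location -/

section Alg

theorem step_cost_le_of_isPhase (hf : ∀ v, 0 ≤ f v) (hκ : ∀ v x, 0 ≤ κ v x) {m : ℕ}
    {cs : ℕ → Config V} {g : Fin R.length → ℝ} (i : Fin R.length) (hmi : m ≤ (i : ℕ))
    (h : IsPhase (alg f κ Rhat) R m ((i : ℕ) + 1) cs g) (z : V) :
    g i ≤ 2 * (f z + κ z (R.get i)) + ∑ j ∈ window m (i : ℕ), g j := by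
  have hi : i ∈ window m ((i : ℕ) + 1) := mem_window.2 ⟨hmi, Nat.lt_succ_self _⟩
  have hfeasible := isFeasible_of_reachable hf (h.reachable i hmi (Nat.le_succ _))
  obtain ⟨a, -, ha⟩ := Step.exists_isDual hκ hfeasible (h.on i hi)
  have hdual := ha.add_reconnection_le
  have hthreshold := ha.le_threshold z
  rw [threshold] at hthreshold
  have := reconnection_le_of_isPhase hf h i hmi (Nat.le_succ _)
  have := reconnection_nonneg hκ (cs ((i : ℕ) + 1))
  have := potential_nonneg (κ := κ) (cs i) z
  linarith

variable {ν x₀ : ℝ} {PC : (Fin Rhat.length → ℝ) → PartialAssignment (Fin Rhat.length) V}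

theorem exists_run_alg [Finite V] [Nonempty V] (hf : ∀ v, 0 ≤ f v) (hκ : ∀ v x, 0 ≤ κ v x)
    (hν : 1 ≤ ν) (hx : 0 < x₀) (hPC : (pc f κ Rhat).IsApprox ν PC) (R : List V) :
    ∃ s, Run (alg f κ Rhat) ν x₀ PC R s :=
  Run.exists_of_isApprox (A := alg f κ Rhat) (S := ⟨∅, fun _ => none⟩) hν hx hPC
    (by simp [alg, pc]) (by simp [alg, pc]) (fun c r _ => exists_step hf c r)
    (fun _ _ _ _ => Step.cost_nonneg hf hκ) R

variable [Finite V] [Nonempty V] {s : FrameworkState (Config V)} {k : ℕ}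
  {H₁ : Finset (Finset (Fin Rhat.length) × Fin R.length)}
  {H₂ : Finset (Finset (Fin R.length) × Fin Rhat.length)}

theorem last_le_of_run_alg (hf : ∀ v, 0 ≤ f v) (hκ : IsConnectionCost κ d) (hν : 0 ≤ ν)
    (hx : 0 < x₀) (hPC : (pc f κ Rhat).IsApprox ν PC) (h : Run (alg f κ Rhat) ν x₀ PC R s)
    (hH₁ : IsHyperedgeCover ⊤ H₁) (hH₂ : IsHyperedgeCover (k : ℕ∞) H₂) :
    s.last ≤ (3 + 4 * ν) * (opt f κ R + clientSplitCost f κ d Rhat R H₁) +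
      12 * (1 + Real.log k) * clientSplitCost f κ d R Rhat H₂ := by
  classical
  have := Real.log_natCast_nonneg k
  have hκ₀ := hκ.cost_nonneg
  have hcover₁ := clientSplitCost_nonneg hf hκ Rhat R H₁
  have hcover₂ := clientSplitCost_nonneg hf hκ R Rhat H₂
  have hopt₀ := opt_nonneg hf hκ₀ R
  obtain ⟨F, a, haF, hopt⟩ := exists_opt_eq f κ R
  obtain ⟨S, hS, hcost⟩ := exists_isComplete_cost_le hf hκ (R := R) hH₁
  have hS₀ := cost_pc_nonneg hf hκ₀ S
  have hlast := h.last_le hν hx hPC (cost_pc_nonneg hf hκ₀)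
    (fun _ _ _ _ => Step.cost_nonneg hf hκ₀) hS (O := 2 * opt f κ R)
    (Y := 2 * (ν * (pc f κ Rhat).cost S) +
      6 * (1 + Real.log k) * clientSplitCost f κ d R Rhat H₂)
    (by positivity) (by positivity)
    (fun i hmi hphase => ?_) (fun {m n cs g c T} hphase hbuy hT hTcost => ?_)
  · change s.last ≤ _ + (pc f κ Rhat).cost S + _ at hlast
    have := mul_le_mul_of_nonneg_left hcost (by positivity : 0 ≤ 4 * ν + 1)
    linarith
  · have hstep := step_cost_le_of_isPhase hf hκ₀ i hmi hphase (a i)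
    have hopening : f (a i) ≤ ∑ v ∈ F, f v := Finset.single_le_sum (fun v _ => hf v) (haF i)
    have hconnection : κ (a i) (R.get i) ≤ ∑ j, κ (a j) (R.get j) :=
      Finset.single_le_sum (f := fun j => κ (a j) (R.get j)) (fun j _ => hκ₀ _ _)
        (Finset.mem_univ i)
    linarith
  · obtain ⟨v, hv, heq⟩ := exists_assign_of_isComplete hT
    have hopened : ∀ j, v j ∈ (cs m).opened := fun j =>
      hbuy ▸ Finset.mem_union_right _ (hv j)
    have hT' : (pc f κ Rhat).cost T ≤ ν * (pc f κ Rhat).cost S := hTcost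
    have := sum_window_le_of_isPhase hf hκ hphase hopened hH₂
    have := Finset.sum_nonneg fun w (_ : w ∈ T.opened) => hf w
    linarith

theorem configCost_le_of_run_alg (hf : ∀ v, 0 ≤ f v) (hκ : IsConnectionCost κ d) (hν : 0 ≤ ν)
    (hx : 0 < x₀) (hPC : (pc f κ Rhat).IsApprox ν PC) (h : Run (alg f κ Rhat) ν x₀ PC R s)
    (hH₁ : IsHyperedgeCover ⊤ H₁) (hH₂ : IsHyperedgeCover (k : ℕ∞) H₂) :
    configCost f κ s.cfg ≤ (2 + 6 * ν) *
      ((3 + 4 * ν) * (opt f κ R + clientSplitCost f κ d Rhat R H₁) +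
        12 * (1 + Real.log k) * clientSplitCost f κ d R Rhat H₂) := by
  have hκ₀ := hκ.cost_nonneg
  calc configCost f κ s.cfg ≤ (2 + 6 * ν) * s.last :=
        h.cost_le_mul_last hν (by simp [alg, configCost])
          (fun _ _ _ _ hon => (Step.configCost_eq hon).le)
          (fun c S => configCost_buy_le hf hκ₀ S c) (fun _ _ _ _ => Step.cost_nonneg hf hκ₀)
    _ ≤ _ := by
        gcongr
        exact last_le_of_run_alg hf hκ hν hx hPC h hH₁ hH₂

end Alg

end Facility

/-! ### Reduction of soft capacities to connection costs -/

theorem Network.isConnectionCost_dist {V : Type u} (N : Network V) :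
    Facility.IsConnectionCost N.dist N.dist where
  nonneg := N.dist_nonneg
  comm := N.dist_comm
  triangle := N.dist_triangle
  le _ _ := le_rfl
  le_add v x y := N.dist_triangle v y x

namespace Facility

variable {V : Type u} {f : V → ℝ} {d : V → V → ℝ} {β : V → ℕ} {R : List V}

theorem IsConnectionCost.capκ (h : IsConnectionCost d d) (hf : ∀ v, 0 ≤ f v) :
    IsConnectionCost (capκ f d β) d where
  nonneg := h.nonneg
  comm := h.comm
  triangle := h.triangle
  le v x := le_add_of_nonneg_right (div_nonneg (hf v) (Nat.cast_nonneg _))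
  le_add v x y := by
    have := h.le_add v x y
    simp only [Facility.capκ]
    linarith

section Opt

variable [DecidableEq V] {m : V → ℕ} {a : Fin R.length → V}

theorem one_le_of_card_fiber_le (hm : ∀ v, (Finset.univ.filter fun i => a i = v).card ≤ m v * β v)
    (i : Fin R.length) : 1 ≤ m (a i) := by
  have hfiber : 0 < (Finset.univ.filter fun j => a j = a i).card :=
    Finset.card_pos.2 ⟨i, by simp⟩
  exact Nat.pos_of_mul_pos_right (hfiber.trans_le (hm (a i)))

variable [Fintype V]

theorem sum_div_capacity_le (hf : ∀ v, 0 ≤ f v)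
    (hm : ∀ v, (Finset.univ.filter fun i => a i = v).card ≤ m v * β v) :
    ∑ i, f (a i) / β (a i) ≤ ∑ v, f v * m v := by
  rw [← Finset.sum_fiberwise Finset.univ a]
  refine Finset.sum_le_sum fun v _ => ?_
  have hload : ((Finset.univ.filter fun i => a i = v).card : ℝ) ≤ m v * β v := mod_cast hm v
  calc ∑ i with a i = v, f (a i) / β (a i)
      = ∑ i with a i = v, f v / β v :=
        Finset.sum_congr rfl fun i hi => by rw [(Finset.mem_filter.1 hi).2]
    _ = (Finset.univ.filter fun i => a i = v).card / (β v : ℝ) * f v := by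
        rw [Finset.sum_const, nsmul_eq_mul]
        ring
    _ ≤ m v * f v :=
        mul_le_mul_of_nonneg_right (div_le_of_le_mul₀ (by positivity) (by positivity) hload) (hf v)
    _ = f v * m v := mul_comm _ _

theorem opt_capκ_le_of_card_fiber_le (hf : ∀ v, 0 ≤ f v) (hd : IsConnectionCost d d)
    (hm : ∀ v, (Finset.univ.filter fun i => a i = v).card ≤ m v * β v) :
    opt f (capκ f d β) R ≤ 2 * ∑ v, f v * m v + ∑ i, d (a i) (R.get i) := by
  have hopt := opt_le (F := Finset.univ.filter fun v => 1 ≤ m v) (a := a) (R := R) hf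
    (hd.capκ (β := β) hf).cost_nonneg fun i => by simpa using one_le_of_card_fiber_le hm i
  have hopened : ∑ v with 1 ≤ m v, f v ≤ ∑ v, f v * m v :=
    (Finset.sum_le_sum fun v hv => le_mul_of_one_le_right (hf v)
      (by exact_mod_cast (Finset.mem_filter.1 hv).2)).trans
      (Finset.sum_le_sum_of_subset_of_nonneg (Finset.filter_subset _ _)
        fun v _ _ => mul_nonneg (hf v) (Nat.cast_nonneg _))
  have := sum_div_capacity_le hf hm
  simp only [capκ, Finset.sum_add_distrib] at hopt
  linarith

end Opt

theorem opt_capκ_le [Fintype V] [Nonempty V] (hf : ∀ v, 0 ≤ f v) (hβ : ∀ v, 1 ≤ β v)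
    (hd : IsConnectionCost d d) (R : List V) : opt f (capκ f d β) R ≤ 2 * capOpt f d β R := by
  classical
  suffices opt f (capκ f d β) R / 2 ≤ capOpt f d β R by linarith
  refine le_csInf ⟨_, fun _ => R.length, fun _ => Classical.arbitrary V, fun v => ?_, rfl⟩ ?_
  · exact ((Finset.card_le_univ _).trans_eq (Fintype.card_fin _)).trans
      (Nat.le_mul_of_pos_right _ (hβ v))
  · rintro _ ⟨m, a, hm, rfl⟩
    have := opt_capκ_le_of_card_fiber_le hf hd hm
    have := Finset.sum_nonneg fun i (_ : i ∈ Finset.univ) => hd.nonneg (a i) (R.get i)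
    linarith

theorem sum_load_mul_le {φ : V → ℝ} (hφ : ∀ v, 0 ≤ φ v) (s : Config V) (F : Finset V) :
    ∑ v ∈ F, (load s v : ℝ) * φ v ≤ (s.conns.map fun p => φ p.2).sum := by
  classical
  unfold load
  induction s.conns with
  | nil => simp
  | cons p l ih =>
    have hcons (v : V) : (((p :: l).filter fun q => decide (q.2 = v)).length : ℝ) * φ v =
        (l.filter fun q => decide (q.2 = v)).length * φ v + if p.2 = v then φ v else 0 := by
      by_cases h : p.2 = v
      · simp [h, add_mul]
      · simp [h]
    have hhead : ∑ v ∈ F, (if p.2 = v then φ v else 0) ≤ φ p.2 := by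
      rw [Finset.sum_ite_eq]
      split_ifs
      exacts [le_rfl, hφ _]
    simp only [hcons, Finset.sum_add_distrib, List.map_cons, List.sum_cons]
    linarith

theorem capConfigCost_le (hf : ∀ v, 0 ≤ f v) (s : Config V) :
    capConfigCost f d β s ≤ configCost f (capκ f d β) s := by
  have hload := sum_load_mul_le (φ := fun v => f v / β v)
    (fun v => div_nonneg (hf v) (Nat.cast_nonneg _)) s s.opened
  have hcopies : ∑ v ∈ s.opened, f v * (max 1 ⌈(load s v : ℝ) / β v⌉₊ : ℕ) ≤
      ∑ v ∈ s.opened, (f v + (load s v : ℝ) * (f v / β v)) := by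
    refine Finset.sum_le_sum fun v _ => ?_
    have hratio : (0 : ℝ) ≤ load s v / β v := by positivity
    have hceil : ((max 1 ⌈(load s v : ℝ) / β v⌉₊ : ℕ) : ℝ) ≤ 1 + load s v / β v := by
      rw [Nat.cast_max, Nat.cast_one]
      exact max_le (by linarith) (by linarith [Nat.ceil_lt_add_one hratio])
    calc _ ≤ f v * (1 + load s v / β v) := mul_le_mul_of_nonneg_left hceil (hf v)
      _ = _ := by ring
  rw [Finset.sum_add_distrib] at hcopies
  simp only [capConfigCost, configCost, capκ, List.sum_map_add]
  linarith

theorem clientSplitCost_le_refinedCost_γ (hf : ∀ v, 0 ≤ f v) (hd : IsConnectionCost d d)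
    (R₁ R₂ : List V) (H : Finset (Finset (Fin R₁.length) × Fin R₂.length)) :
    clientSplitCost f d d R₁ R₂ H ≤ refinedCost (fun b => f (R₂.get b)) (γ f d R₁ R₂) H := by
  rw [← one_mul (refinedCost _ _ _)]
  exact splitCost_le_mul_refinedCost le_rfl (fun _ _ => hd.nonneg _ _)
    (fun _ _ => add_nonneg (hf _) (Finset.sum_nonneg fun _ _ => hd.nonneg _ _))
    (fun _ _ _ => le_rfl) fun _ _ _ => (one_mul _).ge

theorem clientSplitCost_le_refinedCost_capγ (hf : ∀ v, 0 ≤ f v) (hβ : ∀ v, 1 ≤ β v)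
    (hd : IsConnectionCost d d) (R₁ R₂ : List V)
    (H : Finset (Finset (Fin R₁.length) × Fin R₂.length)) :
    clientSplitCost f (capκ f d β) d R₁ R₂ H ≤
      2 * refinedCost (fun b => f (R₂.get b)) (capγ f d β R₁ R₂) H := by
  have hdist (A : Finset (Fin R₁.length)) (b : Fin R₂.length) :
      0 ≤ ∑ p ∈ A, d (R₂.get b) (R₁.get p) :=
    Finset.sum_nonneg fun _ _ => hd.nonneg _ _
  have hopen (A : Finset (Fin R₁.length)) (b : Fin R₂.length) (hA : A.Nonempty) :
      f (R₂.get b) ≤ f (R₂.get b) * (⌈(A.card : ℝ) / β (R₂.get b)⌉₊ : ℕ) := by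
    have hcard : (0 : ℝ) < A.card := mod_cast hA.card_pos
    have hcapacity : (0 : ℝ) < β (R₂.get b) := mod_cast hβ _
    exact le_mul_of_one_le_right (hf _)
      (by exact_mod_cast Nat.ceil_pos.2 (div_pos hcard hcapacity))
  refine splitCost_le_mul_refinedCost one_le_two (fun _ _ => hd.nonneg _ _)
    (fun A b => add_nonneg (mul_nonneg (hf _) (Nat.cast_nonneg _)) (hdist A b))
    (fun A b hA => add_le_add (hopen A b hA) le_rfl) fun A b hA => ?_
  have := hopen A b hA
  have := hdist A b
  have hshare : (A.card : ℝ) * (f (R₂.get b) / β (R₂.get b)) ≤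
      f (R₂.get b) * (⌈(A.card : ℝ) / β (R₂.get b)⌉₊ : ℕ) := by
    rw [mul_div_left_comm]
    exact mul_le_mul_of_nonneg_left (Nat.le_ceil _) (hf _)
  simp only [capκ, capγ, Finset.sum_add_distrib, Finset.sum_const, nsmul_eq_mul]
  linarith

end Facility

/-! ### Competitive ratios -/

/-- The constant in the cost bounds of the learning-augmented algorithms that use a
`ν`-approximation algorithm for the prize-collecting problem. The first factor `2` is the loss in
the reduction of soft capacities, and `2 + 6 * ν` relates the total cost to the online cost at the
latest major iteration. -/
noncomputable def competitiveFactor (ν : ℝ) : ℝ := 2 * (2 + 6 * ν) * (12 + 4 * ν)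

theorem competitiveFactor_pos {ν : ℝ} (hν : 0 ≤ ν) : 0 < competitiveFactor ν := by
  unfold competitiveFactor
  positivity

theorem mul_add_le_competitiveFactor_mul {ν O O' X Y X' Y' L : ℝ} (hν : 0 ≤ ν) (hL : 0 ≤ L)
    (hX₀ : 0 ≤ X) (hY₀ : 0 ≤ Y) (hO : O ≤ 2 * O') (hX : X ≤ 2 * X') (hY : Y ≤ 2 * Y')
    (hO₀ : 0 ≤ O) :
    (2 + 6 * ν) * ((3 + 4 * ν) * (O + X) + 12 * (1 + L) * Y) ≤
      competitiveFactor ν * (O' + (1 + L) * (X' + Y')) := by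
  have hmerge : (3 + 4 * ν) * (O + X) + 12 * (1 + L) * Y ≤
      (12 + 4 * ν) * (O + (1 + L) * (X + Y)) := by
    have : 0 ≤ 9 * (O + X) + L * X * (12 + 4 * ν) + 4 * ν * ((1 + L) * Y) := by positivity
    linarith
  calc _ ≤ (2 + 6 * ν) * ((12 + 4 * ν) * (O + (1 + L) * (X + Y))) := by gcongr
    _ ≤ (2 + 6 * ν) * ((12 + 4 * ν) * (2 * O' + (1 + L) * (2 * X' + 2 * Y'))) := by gcongr
    _ = _ := by
        rw [competitiveFactor]
        ring

theorem Network.ofReal_sum_cost_le_errorBound {V : Type u} [Finite V] [DecidableEq V]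
    (N : Network V) {ν x₀ : ℝ} {ρ : V} {R Rhat : List V}
    {PC : (Fin Rhat.length → ℝ) → Finset (Sym2 V)} (hν : 0 ≤ ν) (hx : 0 < x₀)
    (hPC : (N.steinerPC ρ Rhat).IsApprox ν PC) {s : FrameworkState (Finset (Sym2 V))}
    (h : Run (N.steinerAlg ρ Rhat) ν x₀ PC R s) (k : ℕ) :
    ENNReal.ofReal (∑ e ∈ s.cfg, N.cost e) ≤ errorBound (competitiveFactor ν) k
      (N.steinerOpt ρ R.toFinset) (N.steinerError k R Rhat) :=
  ofReal_le_errorBound (competitiveFactor_pos hν) fun H₁ H₂ hH₁ hH₂ => by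
    have hlog := Real.log_natCast_nonneg k
    have hopt := N.steinerOpt_nonneg ρ R.toFinset
    have hcover₁ := N.sumCost_steinerγ_nonneg Rhat R H₁
    have hcover₂ := N.sumCost_steinerγ_nonneg R Rhat H₂
    calc ∑ e ∈ s.cfg, N.cost e
        ≤ (2 + 6 * ν) * (2 * N.steinerOpt ρ R.toFinset + sumCost (N.steinerγ Rhat R) H₁ +
            4 * (1 + Real.log k) * sumCost (N.steinerγ R Rhat) H₂) :=
          N.sum_cost_le_of_run_steinerAlg hν hx hPC (fun _ => List.mem_toFinset.2) h hH₁ hH₂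
      _ ≤ (2 + 6 * ν) * ((3 + 4 * ν) * (N.steinerOpt ρ R.toFinset +
            sumCost (N.steinerγ Rhat R) H₁) +
            12 * (1 + Real.log k) * sumCost (N.steinerγ R Rhat) H₂) := by
          refine mul_le_mul_of_nonneg_left ?_ (by positivity)
          have := mul_nonneg hν hopt
          have := mul_nonneg hν hcover₁
          have := mul_nonneg hlog hcover₂
          linarith
      _ ≤ _ := mul_add_le_competitiveFactor_mul hν hlog hcover₁ hcover₂ (by linarith)
          (by linarith) (by linarith) hopt

namespace Facility

variable {V : Type u} [Nonempty V] {f : V → ℝ} {d : V → V → ℝ} {R Rhat : List V} {ν x₀ : ℝ}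
  {PC : (Fin Rhat.length → ℝ) → PartialAssignment (Fin Rhat.length) V}
  {s : FrameworkState (Config V)}

theorem ofReal_configCost_le_errorBound [Finite V] (hf : ∀ v, 0 ≤ f v) (hd : IsConnectionCost d d)
    (hν : 0 ≤ ν) (hx : 0 < x₀) (hPC : (pc f d Rhat).IsApprox ν PC)
    (h : Run (alg f d Rhat) ν x₀ PC R s) (k : ℕ) :
    ENNReal.ofReal (configCost f d s.cfg) ≤
      errorBound (competitiveFactor ν) k (opt f d R) (coverError f d k R Rhat) :=
  ofReal_le_errorBound (competitiveFactor_pos hν) fun H₁ H₂ hH₁ hH₂ => by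
    have hopt := opt_nonneg hf hd.cost_nonneg R
    have hcover₁ := clientSplitCost_nonneg hf hd Rhat R H₁
    have hcover₂ := clientSplitCost_nonneg hf hd R Rhat H₂
    have hrefined₁ := clientSplitCost_le_refinedCost_γ hf hd Rhat R H₁
    have hrefined₂ := clientSplitCost_le_refinedCost_γ hf hd R Rhat H₂
    exact (configCost_le_of_run_alg hf hd hν hx hPC h hH₁ hH₂).trans
      (mul_add_le_competitiveFactor_mul hν (Real.log_natCast_nonneg k) hcover₁ hcover₂
        (by linarith) (by linarith) (by linarith) hopt)

theorem ofReal_capConfigCost_le_errorBound [Fintype V] {β : V → ℕ} (hf : ∀ v, 0 ≤ f v)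
    (hβ : ∀ v, 1 ≤ β v) (hd : IsConnectionCost d d) (hν : 0 ≤ ν) (hx : 0 < x₀)
    (hPC : (pc f (capκ f d β) Rhat).IsApprox ν PC)
    (h : Run (alg f (capκ f d β) Rhat) ν x₀ PC R s) (k : ℕ) :
    ENNReal.ofReal (capConfigCost f d β s.cfg) ≤
      errorBound (competitiveFactor ν) k (capOpt f d β R) (capCoverError f d β k R Rhat) :=
  ofReal_le_errorBound (competitiveFactor_pos hν) fun H₁ H₂ hH₁ hH₂ =>
    have hκ : IsConnectionCost (capκ f d β) d := hd.capκ hf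
    calc capConfigCost f d β s.cfg
        ≤ configCost f (capκ f d β) s.cfg := capConfigCost_le hf s.cfg
      _ ≤ (2 + 6 * ν) * ((3 + 4 * ν) *
            (opt f (capκ f d β) R + clientSplitCost f (capκ f d β) d Rhat R H₁) +
            12 * (1 + Real.log k) * clientSplitCost f (capκ f d β) d R Rhat H₂) :=
          configCost_le_of_run_alg hf hκ hν hx hPC h hH₁ hH₂
      _ ≤ _ := mul_add_le_competitiveFactor_mul hν (Real.log_natCast_nonneg k)
          (clientSplitCost_nonneg hf hκ Rhat R H₁) (clientSplitCost_nonneg hf hκ R Rhat H₂)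
          (opt_capκ_le hf hβ hd R) (clientSplitCost_le_refinedCost_capγ hf hβ hd Rhat R H₁)
          (clientSplitCost_le_refinedCost_capγ hf hβ hd R Rhat H₂)
          (opt_nonneg hf hκ.cost_nonneg R)

end Facility

theorem theorem3 (ν : ℝ) (hν : 1 ≤ ν) :
    ∃ C : ℝ, 0 < C ∧
      -- Steiner tree
      (∀ (V : Type u) [Fintype V] [DecidableEq V] (N : Network V) (ρ : V) (R Rhat : List V)
        (x₀ : ℝ) (PC : (Fin Rhat.length → ℝ) → Finset (Sym2 V)),
        0 < x₀ → (N.steinerPC ρ Rhat).IsApprox ν PC →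
        (∃ s, Run (N.steinerAlg ρ Rhat) ν x₀ PC R s) ∧
        ∀ s, Run (N.steinerAlg ρ Rhat) ν x₀ PC R s → ∀ k : ℕ, 1 ≤ k →
          ENNReal.ofReal (∑ e ∈ s.cfg, N.cost e) ≤
            errorBound C k (N.steinerOpt ρ R.toFinset) (N.steinerError k R Rhat)) ∧
      -- facility location
      (∀ (V : Type u) [Fintype V] (N : Network V) (f : V → ℝ) (R Rhat : List V)
        (x₀ : ℝ)
        (PC : (Fin Rhat.length → ℝ) → Facility.PartialAssignment (Fin Rhat.length) V),
        (∀ v, 0 ≤ f v) → 0 < x₀ → (Facility.pc f N.dist Rhat).IsApprox ν PC →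
        (∃ s, Run (Facility.alg f N.dist Rhat) ν x₀ PC R s) ∧
        ∀ s, Run (Facility.alg f N.dist Rhat) ν x₀ PC R s → ∀ k : ℕ, 1 ≤ k →
          ENNReal.ofReal (Facility.configCost f N.dist s.cfg) ≤
            errorBound C k (Facility.opt f N.dist R)
              (Facility.coverError f N.dist k R Rhat)) ∧
      -- soft-capacitated facility location
      (∀ (V : Type u) [Fintype V] (N : Network V) (f : V → ℝ) (β : V → ℕ) (R Rhat : List V)
        (x₀ : ℝ)
        (PC : (Fin Rhat.length → ℝ) → Facility.PartialAssignment (Fin Rhat.length) V),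
        (∀ v, 0 ≤ f v) → (∀ v, 1 ≤ β v) → 0 < x₀ →
        (Facility.pc f (Facility.capκ f N.dist β) Rhat).IsApprox ν PC →
        (∃ s, Run (Facility.alg f (Facility.capκ f N.dist β) Rhat) ν x₀ PC R s) ∧
        ∀ s, Run (Facility.alg f (Facility.capκ f N.dist β) Rhat) ν x₀ PC R s →
          ∀ k : ℕ, 1 ≤ k →
          ENNReal.ofReal (Facility.capConfigCost f N.dist β s.cfg) ≤
            errorBound C k (Facility.capOpt f N.dist β R)
              (Facility.capCoverError f N.dist β k R Rhat)) := by
  refine ⟨competitiveFactor ν, competitiveFactor_pos (zero_le_one.trans hν), ?_, ?_, ?_⟩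
  · intro V _ _ N ρ R Rhat x₀ PC hx hPC
    exact ⟨N.exists_run_steinerAlg hν hx hPC R,
      fun s hs k _ => N.ofReal_sum_cost_le_errorBound (zero_le_one.trans hν) hx hPC hs k⟩
  · intro V _ N f R Rhat x₀ PC hf hx hPC
    have := N.connected.nonempty
    have hd := N.isConnectionCost_dist
    exact ⟨Facility.exists_run_alg hf hd.cost_nonneg hν hx hPC R, fun s hs k _ =>
      Facility.ofReal_configCost_le_errorBound hf hd (zero_le_one.trans hν) hx hPC hs k⟩
  · intro V _ N f β R Rhat x₀ PC hf hβ hx hPC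
    have := N.connected.nonempty
    have hd := N.isConnectionCost_dist
    have hκ : Facility.IsConnectionCost (Facility.capκ f N.dist β) N.dist := hd.capκ hf
    exact ⟨Facility.exists_run_alg hf hκ.cost_nonneg hν hx hPC R, fun s hs k _ =>
      Facility.ofReal_capConfigCost_le_errorBound hf hβ hd (zero_le_one.trans hν) hx hPC hs k⟩
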